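/- A super-ring is a unital ring $A=A_0\oplus A_1$ graded by $\mathbb Z/2$ that is super-commutative: even elements commute with all homogeneous elements, and $s^2=0$ for every $s\in A_1$. A super-ideal is a homogeneous ideal; $A$ is Noetherian if its super-ideals satisfy the ascending chain condition. A super-ideal $\mathfrak p$ is called maximal if $A/\mathfrak p$ is a field, and $(A,\mathfrak m)$ is local if $\mathfrak m$ is the unique maximal super-ideal of $A$. Odd elements $y_1,\dots,y_s\in A_1$ form a system of odd parameters if $\mathrm{Kdim}(A_0)=\mathrm{Kdim}\bigl(A_0/\mathrm{Ann}_{A_0}(y_1\cdots y_s)\bigr)$, where $\mathrm{Kdim}$ is the Krull dimension (for $s=0$ the product is $1$). The Krull super-dimension is $\mathrm{Ksdim}(A)=r\mid s$, where $r=\mathrm{Kdim}(A_0)$ and $s$ is the largest length of a system of odd parameters. Let $(A,\mathfrak m)$ be a Noetherian local super-ring with residue field $K=A/\mathfrak m$. Then $\mathfrak m/\mathfrak m^2$ is a super-vector space over $K$ whose component $(\mathfrak m/\mathfrak m^2)_i$ is the image of $\mathfrak m\cap A_i$ ($i=0,1$), and $\mathrm{sdim}_K(\mathfrak m/\mathfrak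 m^2)=\dim_K(\mathfrak m/\mathfrak m^2)_0\mid\dim_K(\mathfrak m/\mathfrak m^2)_1$. The super-ring $A$ is called regular if $\mathrm{Ksdim}(A)=\mathrm{sdim}_K(\mathfrak m/\mathfrak m^2)$. Let $\mathrm{gr}_{\mathfrak m}(A)=\bigoplus_{n\ge0}\mathfrak m^n/\mathfrak m^{n+1}$, a graded $K$-superalgebra, and let $$\kappa_A: S_K\bigl((\mathfrak m/\mathfrak m^2)_0\bigr)\otimes_K\wedge_K\bigl((\mathfrak m/\mathfrak m^2)_1\bigr)\to \mathrm{gr}_{\mathfrak m}(A)$$ be the graded $K$-superalgebra map from the tensor product of the symmetric and the exterior algebra that is induced by the inclusion of $\mathfrak m/\mathfrak m^2$ in $\mathrm{gr}_{\mathfrak m}(A)$ as the degree-one component. Theorem. The map $\kappa_A$ is surjective, and $A$ is regular if and only if $\kappa_A$ is an isomorphism. -/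

import Mathlib

open scoped TensorProduct DirectSum

namespace SuperRing

set_option linter.unusedSectionVars false

universe u

/-! ### Super-commutative super-rings -/

section Basic

variable {A : Type u} [Ring A]

/-- A super-ring `A = A₀ ⊕ A₁` (a `ℤ/2`-graded ring) is super-commutative if even elements are
central (it suffices that they commute with homogeneous elements) and odd elements square to
zero. -/
class SuperCommutative (𝒜 : ZMod 2 → AddSubgroup A) : Prop where
  even_comm : ∀ {i : ZMod 2} {r s : A}, r ∈ 𝒜 0 → s ∈ 𝒜 i → r * s = s * r
  odd_sq : ∀ {s : A}, s ∈ 𝒜 1 → s * s = 0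

variable (𝒜 : ZMod 2 → AddSubgroup A) [GradedRing 𝒜]

theorem eq_even_add_odd (a : A) :
    a = (DirectSum.decompose 𝒜 a 0 : A) + (DirectSum.decompose 𝒜 a 1 : A) := by
  classical
  conv_lhs => rw [← DirectSum.sum_support_decompose 𝒜 a]
  rw [Finset.sum_subset (Finset.subset_univ _) (fun i _ hi => by
    rw [DFinsupp.notMem_support_iff.1 hi, ZeroMemClass.coe_zero])]
  exact Fin.sum_univ_two _

theorem exists_even_add_odd (a : A) : ∃ b ∈ 𝒜 0, ∃ c ∈ 𝒜 1, a = b + c :=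
  ⟨_, (DirectSum.decompose 𝒜 a 0).2, _, (DirectSum.decompose 𝒜 a 1).2, eq_even_add_odd 𝒜 a⟩

/-- A super-ring is Noetherian if its super-ideals (homogeneous ideals) satisfy the ascending
chain condition. -/
abbrev IsNoetherianSuperRing : Prop := WellFoundedGT (HomogeneousIdeal 𝒜)

variable [SuperCommutative 𝒜]

theorem even_commute {r : A} (hr : r ∈ 𝒜 0) (s : A) : r * s = s * r := by
  obtain ⟨b, hb, c, hc, rfl⟩ := exists_even_add_odd 𝒜 s
  rw [mul_add, add_mul, SuperCommutative.even_comm hr hb, SuperCommutative.even_comm hr hc]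

theorem odd_anticommute {r s : A} (hr : r ∈ 𝒜 1) (hs : s ∈ 𝒜 1) : r * s = -(s * r) := by
  have h := SuperCommutative.odd_sq (𝒜 := 𝒜) ((𝒜 1).add_mem hr hs)
  have h1 := SuperCommutative.odd_sq (𝒜 := 𝒜) hr
  have h2 := SuperCommutative.odd_sq (𝒜 := 𝒜) hs
  rw [mul_add, add_mul, add_mul, h1, h2, zero_add, add_zero] at h
  exact eq_neg_of_add_eq_zero_right h

/-- The even part of a super-commutative super-ring is a commutative ring. -/
instance evenCommRing : CommRing (𝒜 0) where
  __ := SetLike.GradeZero.instRing 𝒜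
  mul_comm a b := Subtype.ext (even_commute 𝒜 a.2 b)

/-- Every (left) super-ideal of a super-commutative super-ring is two-sided. -/
instance isTwoSided (I : HomogeneousIdeal 𝒜) : I.toIdeal.IsTwoSided where
  mul_mem_of_left {a} b ha := by
    have h0 : (DirectSum.decompose 𝒜 a 0 : A) ∈ I.toIdeal := I.isHomogeneous 0 ha
    have h1 : (DirectSum.decompose 𝒜 a 1 : A) ∈ I.toIdeal := I.isHomogeneous 1 ha
    obtain ⟨c, hc, d, hd, rfl⟩ := exists_even_add_odd 𝒜 b
    rw [mul_add, ← even_commute 𝒜 hc]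
    refine add_mem (I.toIdeal.mul_mem_left _ ha) ?_
    rw [eq_even_add_odd 𝒜 a, add_mul,
      even_commute 𝒜 (DirectSum.decompose 𝒜 a 0).2 d,
      odd_anticommute 𝒜 (DirectSum.decompose 𝒜 a 1).2 hd]
    exact add_mem (I.toIdeal.mul_mem_left _ h0) (neg_mem (I.toIdeal.mul_mem_left _ h1))

variable {𝒜}

/-- A super-ideal `𝔪` is maximal if `A / 𝔪` is a field. -/
class IsMaximalSuperIdeal (m : HomogeneousIdeal 𝒜) : Prop where
  isField : IsField (A ⧸ m.toIdeal)

/-- `(A, 𝔪)` is a local super-ring: `𝔪` is the unique maximal super-ideal of `A`. -/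
class IsLocalSuperRing (m : HomogeneousIdeal 𝒜) : Prop extends IsMaximalSuperIdeal m where
  unique : ∀ n : HomogeneousIdeal 𝒜, IsMaximalSuperIdeal n → n = m

/-! ### Krull super-dimension -/

variable (𝒜)

/-- The ideal `Ann_{A₀}(a)` of the even part. -/
def evenAnnihilator (a : A) : Ideal (𝒜 0) where
  carrier := {r | (r : A) * a = 0}
  add_mem' {r s} hr hs := by
    change ((r + s : 𝒜 0) : A) * a = 0
    rw [AddSubgroup.coe_add, add_mul, show (r : A) * a = 0 from hr, show (s : A) * a = 0 from hs,
      add_zero]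
  zero_mem' := zero_mul a
  smul_mem' r s hs := by
    change ((r : A) * (s : A)) * a = 0
    rw [mul_assoc, show (s : A) * a = 0 from hs, mul_zero]

/-- The odd elements `y₁, …, yₛ` form a system of odd parameters if
`Kdim A₀ = Kdim (A₀ / Ann_{A₀}(y₁ ⋯ yₛ))`. -/
def IsSystemOfOddParameters {s : ℕ} (y : Fin s → 𝒜 1) : Prop :=
  ringKrullDim (𝒜 0) =
    ringKrullDim (𝒜 0 ⧸ evenAnnihilator 𝒜 (List.ofFn fun i => (y i : A)).prod)

/-- The even Krull dimension: the Krull dimension of `A₀`. -/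
noncomputable def evenKrullDim : WithBot ℕ∞ := ringKrullDim (𝒜 0)

/-- The odd Krull dimension: the largest size of a system of odd parameters. -/
noncomputable def oddKrullDim : ℕ∞ :=
  ⨆ (s : ℕ) (_ : ∃ y : Fin s → 𝒜 1, IsSystemOfOddParameters 𝒜 y), (s : ℕ∞)

/-- The Krull super-dimension `r | s`. -/
noncomputable def krullSuperDim : WithBot ℕ∞ × ℕ∞ := (evenKrullDim 𝒜, oddKrullDim 𝒜)

end Basic

/-! ### The associated graded ring of a two-sided ideal -/

section Gr

variable {A : Type u} [Ring A] (I : Ideal A)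

/-- The quotient `Iⁿ / Iⁿ⁺¹`. -/
def GrPiece (n : ℕ) : Type u := ↥(I ^ n) ⧸ (I ^ (n + 1)).submoduleOf (I ^ n)

instance (n : ℕ) : AddCommGroup (GrPiece I n) :=
  inferInstanceAs (AddCommGroup (↥(I ^ n) ⧸ (I ^ (n + 1)).submoduleOf (I ^ n)))

instance (n : ℕ) : Module A (GrPiece I n) :=
  inferInstanceAs (Module A (↥(I ^ n) ⧸ (I ^ (n + 1)).submoduleOf (I ^ n)))

/-- The class of an element of `Iⁿ` in `Iⁿ / Iⁿ⁺¹`. -/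
def grMk (n : ℕ) : ↥(I ^ n) →ₗ[A] GrPiece I n := ((I ^ (n + 1)).submoduleOf (I ^ n)).mkQ

variable {I}

theorem grMk_surjective (n : ℕ) : Function.Surjective (grMk I n) := Submodule.mkQ_surjective _

theorem grMk_eq_iff {n : ℕ} {a b : ↥(I ^ n)} :
    grMk I n a = grMk I n b ↔ (a : A) - b ∈ I ^ (n + 1) :=
  Submodule.Quotient.eq _

theorem gradedMonoid_mk_congr {i j : ℕ} {a : ↥(I ^ i)} {b : ↥(I ^ j)} (h : i = j)
    (hab : (a : A) - b ∈ I ^ (j + 1)) :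
    (GradedMonoid.mk i (grMk I i a) : GradedMonoid (GrPiece I)) =
      GradedMonoid.mk j (grMk I j b) := by
  subst h
  rw [grMk_eq_iff.2 hab]

variable [I.IsTwoSided]

theorem mul_mem_pow_add {i j : ℕ} {a b : A} (ha : a ∈ I ^ i) (hb : b ∈ I ^ j) :
    a * b ∈ I ^ (i + j) := by
  rw [Ideal.IsTwoSided.pow_add]
  exact Ideal.mul_mem_mul ha hb

variable (I)

/-- The multiplication `Iⁱ / Iⁱ⁺¹ × Iʲ / Iʲ⁺¹ → Iⁱ⁺ʲ / Iⁱ⁺ʲ⁺¹`, `(ā, b̄) ↦ class of ab`. -/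
def grMul {i j : ℕ} (x : GrPiece I i) (y : GrPiece I j) : GrPiece I (i + j) :=
  Quotient.map₂ (fun a b => (⟨a.1 * b.1, mul_mem_pow_add a.2 b.2⟩ : ↥(I ^ (i + j))))
    (fun a a' h b b' h' => by
      rw [← Quotient.eq_iff_equiv] at h h' ⊢
      have h1 : a.1 - a'.1 ∈ I ^ (i + 1) := grMk_eq_iff.1 h
      have h2 : b.1 - b'.1 ∈ I ^ (j + 1) := grMk_eq_iff.1 h'
      refine grMk_eq_iff.2 ?_
      have e : a.1 * b.1 - a'.1 * b'.1 = (a.1 - a'.1) * b.1 + a'.1 * (b.1 - b'.1) := by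
        noncomm_ring
      change a.1 * b.1 - a'.1 * b'.1 ∈ _
      rw [e]
      have h3 : (a.1 - a'.1) * b.1 ∈ I ^ (i + 1 + j) := mul_mem_pow_add h1 b.2
      have h4 : a'.1 * (b.1 - b'.1) ∈ I ^ (i + (j + 1)) := mul_mem_pow_add a'.2 h2
      rw [add_right_comm] at h3
      rw [← add_assoc] at h4
      exact add_mem h3 h4) x y

theorem grMul_grMk {i j : ℕ} (a : ↥(I ^ i)) (b : ↥(I ^ j)) :
    grMul I (grMk I i a) (grMk I j b) =
      grMk I (i + j) ⟨a.1 * b.1, mul_mem_pow_add a.2 b.2⟩ := rfl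

theorem one_mem_pow_zero : (1 : A) ∈ I ^ 0 := by
  rw [Submodule.pow_zero, Ideal.one_eq_top]
  trivial

instance : GradedMonoid.GMul (GrPiece I) := ⟨fun x y => grMul I x y⟩

instance : GradedMonoid.GOne (GrPiece I) := ⟨grMk I 0 ⟨1, one_mem_pow_zero I⟩⟩

theorem gradedMonoid_mk_mul_mk {i j : ℕ} (a : ↥(I ^ i)) (b : ↥(I ^ j)) :
    (GradedMonoid.mk i (grMk I i a) * GradedMonoid.mk j (grMk I j b) :
      GradedMonoid (GrPiece I)) =
      GradedMonoid.mk (i + j) (grMk I (i + j) ⟨a.1 * b.1, mul_mem_pow_add a.2 b.2⟩) := rfl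

theorem gradedMonoid_one :
    (1 : GradedMonoid (GrPiece I)) = GradedMonoid.mk 0 (grMk I 0 ⟨1, one_mem_pow_zero I⟩) := rfl

instance grRing : DirectSum.GRing (GrPiece I) where
  mul_zero {i j} x := by
    obtain ⟨a, rfl⟩ := grMk_surjective i x
    rw [← map_zero (grMk I j)]
    refine (grMul_grMk I a 0).trans ?_
    rw [← map_zero (grMk I (i + j))]
    congr 1
    exact Subtype.ext (mul_zero _)
  zero_mul {i j} x := by
    obtain ⟨a, rfl⟩ := grMk_surjective j x
    rw [← map_zero (grMk I i)]
    refine (grMul_grMk I 0 a).trans ?_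
    rw [← map_zero (grMk I (i + j))]
    congr 1
    exact Subtype.ext (zero_mul _)
  mul_add {i j} x y z := by
    obtain ⟨a, rfl⟩ := grMk_surjective i x
    obtain ⟨b, rfl⟩ := grMk_surjective j y
    obtain ⟨c, rfl⟩ := grMk_surjective j z
    rw [← map_add]
    refine (grMul_grMk I a (b + c)).trans ?_
    change _ = grMul I _ _ + grMul I _ _
    rw [grMul_grMk, grMul_grMk, ← map_add]
    congr 1
    exact Subtype.ext (mul_add _ _ _)
  add_mul {i j} x y z := by
    obtain ⟨a, rfl⟩ := grMk_surjective i x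
    obtain ⟨b, rfl⟩ := grMk_surjective i y
    obtain ⟨c, rfl⟩ := grMk_surjective j z
    rw [← map_add]
    refine (grMul_grMk I (a + b) c).trans ?_
    change _ = grMul I _ _ + grMul I _ _
    rw [grMul_grMk, grMul_grMk, ← map_add]
    congr 1
    exact Subtype.ext (add_mul _ _ _)
  one_mul := by
    rintro ⟨i, x⟩
    obtain ⟨a, rfl⟩ := grMk_surjective i x
    rw [gradedMonoid_one]
    refine (gradedMonoid_mk_mul_mk I _ a).trans (gradedMonoid_mk_congr (zero_add i) ?_)
    simp
  mul_one := by
    rintro ⟨i, x⟩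
    obtain ⟨a, rfl⟩ := grMk_surjective i x
    rw [gradedMonoid_one]
    refine (gradedMonoid_mk_mul_mk I a _).trans (gradedMonoid_mk_congr (add_zero i) ?_)
    simp
  mul_assoc := by
    rintro ⟨i, x⟩ ⟨j, y⟩ ⟨k, z⟩
    obtain ⟨a, rfl⟩ := grMk_surjective i x
    obtain ⟨b, rfl⟩ := grMk_surjective j y
    obtain ⟨c, rfl⟩ := grMk_surjective k z
    refine (gradedMonoid_mk_congr (add_assoc i j k) ?_ :
      GradedMonoid.mk _ (grMk I (i + j + k)
        ⟨(a.1 * b.1) * c.1, mul_mem_pow_add (mul_mem_pow_add a.2 b.2) c.2⟩) =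
      GradedMonoid.mk _ (grMk I (i + (j + k))
        ⟨a.1 * (b.1 * c.1), mul_mem_pow_add a.2 (mul_mem_pow_add b.2 c.2)⟩))
    simp [mul_assoc]
  natCast n := n • GradedMonoid.GOne.one
  natCast_zero := zero_smul _ _
  natCast_succ n := succ_nsmul _ n
  intCast n := n • GradedMonoid.GOne.one
  intCast_ofNat n := natCast_zsmul _ n
  intCast_negSucc_ofNat n := negSucc_zsmul _ n

end Gr

/-! ### The cotangent super-space and the map `κ` -/

section Kappa

variable {A : Type u} [Ring A] {𝒜 : ZMod 2 → AddSubgroup A} [GradedRing 𝒜] [SuperCommutative 𝒜]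
variable (m : HomogeneousIdeal 𝒜)

/-- `K = A / 𝔪`. -/
abbrev ResidueField : Type u := A ⧸ m.toIdeal

/-- `gr_𝔪(A) = ⨁ₙ 𝔪ⁿ / 𝔪ⁿ⁺¹`. -/
abbrev Gr : Type u := ⨁ n : ℕ, GrPiece m.toIdeal n

variable [hm : IsMaximalSuperIdeal m]

noncomputable instance residueField : Field (ResidueField m) where
  __ := Ideal.Quotient.ring m.toIdeal
  __ := hm.isField.toField

theorem isTorsionBySet_grPiece (n : ℕ) :
    Module.IsTorsionBySet A (GrPiece m.toIdeal n) (m.toIdeal : Set A) := by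
  rintro x ⟨a, ha⟩
  obtain ⟨b, rfl⟩ := grMk_surjective n x
  change a • _ = _
  rw [← map_smul, ← map_zero (grMk m.toIdeal n), grMk_eq_iff]
  have : a * b.1 ∈ m.toIdeal ^ (n + 1) := by
    rw [Ideal.IsTwoSided.pow_succ]
    exact Ideal.mul_mem_mul ha b.2
  simpa using this

/-- `𝔪ⁿ / 𝔪ⁿ⁺¹` is a `K`-vector space through left multiplication. -/
noncomputable instance grPieceModule (n : ℕ) :
    Module (ResidueField m) (GrPiece m.toIdeal n) :=
  (isTorsionBySet_grPiece m n).module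

theorem mk_smul_grMk {n : ℕ} (a : A) (b : ↥(m.toIdeal ^ n)) :
    (Ideal.Quotient.mk m.toIdeal a : ResidueField m) • grMk m.toIdeal n b =
      grMk m.toIdeal n (a • b) := rfl

theorem odd_mem {a : A} (ha : a ∈ 𝒜 1) : a ∈ m.toIdeal := by
  have h : (Ideal.Quotient.mk m.toIdeal a : ResidueField m) * Ideal.Quotient.mk m.toIdeal a = 0 := by
    rw [← map_mul, SuperCommutative.odd_sq ha, map_zero]
  exact Ideal.Quotient.eq_zero_iff_mem.1 (mul_self_eq_zero.1 h)

theorem odd_mul_mem {n : ℕ} {a b : A} (ha : a ∈ 𝒜 1) (hb : b ∈ m.toIdeal ^ n) :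
    a * b ∈ m.toIdeal ^ (n + 1) := by
  rw [Ideal.IsTwoSided.pow_succ]
  exact Ideal.mul_mem_mul (odd_mem m ha) hb

theorem mul_sub_mul_mem {n : ℕ} (a : A) {b : A} (hb : b ∈ m.toIdeal ^ n) :
    a * b - b * a ∈ m.toIdeal ^ (n + 1) := by
  obtain ⟨c, hc, d, hd, rfl⟩ := exists_even_add_odd 𝒜 a
  rw [add_mul, mul_add, even_commute 𝒜 hc, add_sub_add_left_eq_sub]
  refine sub_mem (odd_mul_mem m hd hb) ?_
  have hd' : d ∈ m.toIdeal ^ 1 := by rw [Submodule.pow_one]; exact odd_mem m hd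
  exact mul_mem_pow_add hb hd'

/-- `gr_𝔪(A)` is a graded `K`-algebra. -/
noncomputable instance grAlgebra : DirectSum.GAlgebra (ResidueField m) (GrPiece m.toIdeal) where
  toFun := AddMonoidHom.flip (smulAddHom (ResidueField m) (GrPiece m.toIdeal 0))
    GradedMonoid.GOne.one
  map_one := one_smul (ResidueField m) (GradedMonoid.GOne.one : GrPiece m.toIdeal 0)
  map_mul r s := by
    obtain ⟨a, rfl⟩ := Ideal.Quotient.mk_surjective r
    obtain ⟨b, rfl⟩ := Ideal.Quotient.mk_surjective s
    refine (gradedMonoid_mk_congr (I := m.toIdeal) (i := 0) (j := 0 + 0)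
      (a := (a * b) • ⟨1, one_mem_pow_zero _⟩)
      (b := ⟨(a • (1 : A)) * (b • (1 : A)), mul_mem_pow_add
        (Submodule.smul_mem _ a (one_mem_pow_zero _))
        (Submodule.smul_mem _ b (one_mem_pow_zero _))⟩) rfl ?_)
    simp
  commutes r x := by
    obtain ⟨a, rfl⟩ := Ideal.Quotient.mk_surjective r
    obtain ⟨n, x⟩ := x
    obtain ⟨b, rfl⟩ := grMk_surjective n x
    refine (gradedMonoid_mk_congr (I := m.toIdeal) (i := 0 + n) (j := n + 0)
      (a := ⟨(a • (1 : A)) * b.1, mul_mem_pow_add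
        (Submodule.smul_mem _ a (one_mem_pow_zero _)) b.2⟩)
      (b := ⟨b.1 * (a • (1 : A)), mul_mem_pow_add b.2
        (Submodule.smul_mem _ a (one_mem_pow_zero _))⟩) (by omega) ?_)
    simpa using mul_sub_mul_mem m a b.2
  smul_def r x := by
    obtain ⟨a, rfl⟩ := Ideal.Quotient.mk_surjective r
    obtain ⟨n, x⟩ := x
    obtain ⟨b, rfl⟩ := grMk_surjective n x
    refine (gradedMonoid_mk_congr (I := m.toIdeal) (i := n) (j := 0 + n) (a := a • b)
      (b := ⟨(a • (1 : A)) * b.1, mul_mem_pow_add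
        (Submodule.smul_mem _ a (one_mem_pow_zero _)) b.2⟩) (by omega) ?_)
    simp

/-- The homogeneous component `(𝔪/𝔪²)ᵢ` of the super-vector space `𝔪/𝔪²`: the classes of the
elements of `𝔪 ∩ Aᵢ`. Here `𝔪/𝔪²` is the degree-one piece of `gr_𝔪(A)`. -/
def cotangentPart (i : ZMod 2) : Submodule (ResidueField m) (GrPiece m.toIdeal 1) where
  carrier := {x | ∃ a : ↥(m.toIdeal ^ 1), (a : A) ∈ 𝒜 i ∧ grMk m.toIdeal 1 a = x}
  add_mem' := by
    rintro _ _ ⟨a, ha, rfl⟩ ⟨b, hb, rfl⟩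
    exact ⟨a + b, (𝒜 i).add_mem ha hb, map_add _ _ _⟩
  zero_mem' := ⟨0, (𝒜 i).zero_mem, map_zero _⟩
  smul_mem' := by
    rintro r _ ⟨a, ha, rfl⟩
    obtain ⟨c, rfl⟩ := Ideal.Quotient.mk_surjective r
    obtain ⟨d, hd, e, he, rfl⟩ := exists_even_add_odd 𝒜 c
    refine ⟨d • a, ?_, ?_⟩
    · have := SetLike.mul_mem_graded hd ha
      rwa [zero_add] at this
    · rw [mk_smul_grMk, grMk_eq_iff]
      have : d * a.1 - (d + e) * a.1 = -(e * a.1) := by rw [add_mul]; abel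
      change d * a.1 - (d + e) * a.1 ∈ _
      rw [this]
      exact neg_mem (odd_mul_mem m he a.2)

/-- The super-dimension `sdim_K(𝔪/𝔪²) = dim_K (𝔪/𝔪²)₀ | dim_K (𝔪/𝔪²)₁`. -/
noncomputable def cotangentSuperDim : ℕ∞ × ℕ∞ :=
  (Cardinal.toENat (Module.rank (ResidueField m) (cotangentPart m 0)),
    Cardinal.toENat (Module.rank (ResidueField m) (cotangentPart m 1)))

/-- A local super-ring `(A, 𝔪)` is regular if `Ksdim(A) = sdim_K(𝔪/𝔪²)`. -/
def IsRegular : Prop :=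
  krullSuperDim 𝒜 = (((cotangentSuperDim m).1 : WithBot ℕ∞), (cotangentSuperDim m).2)

/-- The embedding `(𝔪/𝔪²)ᵢ → gr_𝔪(A)`. -/
noncomputable def cotangentIncl (i : ZMod 2) : cotangentPart m i →ₗ[ResidueField m] Gr m :=
  DirectSum.lof (ResidueField m) ℕ (GrPiece m.toIdeal) 1 ∘ₗ (cotangentPart m i).subtype

theorem cotangentIncl_even_comm (i : ZMod 2) (x : cotangentPart m 0) (y : cotangentPart m i) :
    cotangentIncl m 0 x * cotangentIncl m i y = cotangentIncl m i y * cotangentIncl m 0 x := by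
  obtain ⟨x, a, ha, rfl⟩ := x
  obtain ⟨y, b, hb, rfl⟩ := y
  refine (DirectSum.of_mul_of _ _).trans (Eq.trans ?_ (DirectSum.of_mul_of _ _).symm)
  refine congrArg (DirectSum.of (GrPiece m.toIdeal) (1 + 1)) ?_
  refine (grMul_grMk _ a b).trans (Eq.trans ?_ (grMul_grMk _ b a).symm)
  exact congrArg (grMk m.toIdeal (1 + 1)) (Subtype.ext (even_commute 𝒜 ha _))

theorem cotangentIncl_odd_sq (x : cotangentPart m 1) :
    cotangentIncl m 1 x * cotangentIncl m 1 x = 0 := by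
  obtain ⟨x, a, ha, rfl⟩ := x
  refine (DirectSum.of_mul_of _ _).trans ?_
  refine Eq.trans (congrArg (DirectSum.of (GrPiece m.toIdeal) (1 + 1)) ?_) (map_zero _)
  refine (grMul_grMk _ a a).trans ?_
  refine Eq.trans (congrArg (grMk m.toIdeal (1 + 1)) (Subtype.ext ?_)) (map_zero _)
  exact SuperCommutative.odd_sq ha

theorem even_range_comm : ∀ a ∈ Set.range (cotangentIncl m 0), ∀ b ∈ Set.range (cotangentIncl m 0),
    a * b = b * a := by
  rintro _ ⟨x, rfl⟩ _ ⟨y, rfl⟩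
  exact cotangentIncl_even_comm m 0 x y

/-- The subalgebra of `gr_𝔪(A)` generated by `(𝔪/𝔪²)₀`, which is commutative. -/
noncomputable def evenSubalgebra : Subalgebra (ResidueField m) (Gr m) :=
  Algebra.adjoin (ResidueField m) (Set.range (cotangentIncl m 0))

noncomputable instance evenSubalgebraCommRing : CommRing (evenSubalgebra m) where
  __ := (evenSubalgebra m).toRing
  mul_comm := (Algebra.isMulCommutative_adjoin (ResidueField m) (even_range_comm m)).is_comm.comm

/-- The embedding of `(𝔪/𝔪²)₀` in the commutative subalgebra that it generates. -/
noncomputable def cotangentEven : cotangentPart m 0 →ₗ[ResidueField m] evenSubalgebra m :=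
  (cotangentIncl m 0).codRestrict (Subalgebra.toSubmodule (evenSubalgebra m))
    (fun x => Algebra.subset_adjoin ⟨x, rfl⟩)

/-- The `K`-algebra map `S_K((𝔪/𝔪²)₀) → gr_𝔪(A)` induced by the embedding of `(𝔪/𝔪²)₀`; it takes
values in the commutative subalgebra generated by `(𝔪/𝔪²)₀`. -/
noncomputable def kappaEven :
    SymmetricAlgebra (ResidueField m) (cotangentPart m 0) →ₐ[ResidueField m] Gr m :=
  (evenSubalgebra m).val.comp (SymmetricAlgebra.lift (cotangentEven m))

theorem kappaEven_ι (x : cotangentPart m 0) :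
    kappaEven m (SymmetricAlgebra.ι _ _ x) = cotangentIncl m 0 x := by
  have h := SymmetricAlgebra.lift_ι_apply (cotangentEven m) x
  rw [kappaEven, AlgHom.comp_apply, h]
  rfl

/-- The `K`-algebra map `∧_K((𝔪/𝔪²)₁) → gr_𝔪(A)` induced by the embedding of `(𝔪/𝔪²)₁`. -/
noncomputable def kappaOdd :
    ExteriorAlgebra (ResidueField m) (cotangentPart m 1) →ₐ[ResidueField m] Gr m :=
  ExteriorAlgebra.lift (ResidueField m) ⟨cotangentIncl m 1, cotangentIncl_odd_sq m⟩

theorem kappaOdd_ι (x : cotangentPart m 1) :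
    kappaOdd m (ExteriorAlgebra.ι _ x) = cotangentIncl m 1 x :=
  ExteriorAlgebra.lift_ι_apply _ _ _ x

theorem kappa_commute (s : SymmetricAlgebra (ResidueField m) (cotangentPart m 0))
    (w : ExteriorAlgebra (ResidueField m) (cotangentPart m 1)) :
    Commute (kappaEven m s) (kappaOdd m w) := by
  induction s using SymmetricAlgebra.induction with
  | algebraMap r => rw [AlgHom.commutes]; exact Algebra.commute_algebraMap_left _ _
  | mul a b ha hb => rw [map_mul]; exact ha.mul_left hb
  | add a b ha hb => rw [map_add]; exact ha.add_left hb
  | ι x =>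
    rw [kappaEven_ι]
    induction w using ExteriorAlgebra.induction with
    | algebraMap r => rw [AlgHom.commutes]; exact Algebra.commute_algebraMap_right _ _
    | mul a b ha hb => rw [map_mul]; exact ha.mul_right hb
    | add a b ha hb => rw [map_add]; exact ha.add_right hb
    | ι y => rw [kappaOdd_ι]; exact cotangentIncl_even_comm m 1 x y

/-- The graded `K`-superalgebra map
`κ_A : S_K((𝔪/𝔪²)₀) ⊗_K ∧_K((𝔪/𝔪²)₁) → gr_𝔪(A)` induced by the embedding `𝔪/𝔪² → gr_𝔪(A)`.
Since the first factor is purely even, the tensor product of superalgebras is the usual one. -/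
noncomputable def kappa :
    SymmetricAlgebra (ResidueField m) (cotangentPart m 0) ⊗[ResidueField m]
      ExteriorAlgebra (ResidueField m) (cotangentPart m 1) →ₐ[ResidueField m] Gr m :=
  Algebra.TensorProduct.lift (kappaEven m) (kappaOdd m) (kappa_commute m)

end Kappa

end SuperRing

/-! Surjectivity holds because `gr` is generated in degree one, and every class in 𝔪/𝔪² is the sum
of an even and an odd class. For the equivalence, lift bases of the two components of 𝔪/𝔪² to even
x₁,…,x_r and odd θ₁,…,θ_q, and put P = θ₁⋯θ_q, 𝔪₀ = 𝔪 ∩ A₀, I = A₁². By Nakayama's lemma 𝔪₀ = (x) +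
I, and the θ generate A₁ over A₀ (`Parameters.evenPart_eq`, `Parameters.span_θ`). Hence A₁^(q+1) = 0
and A₁^q = A₀P, so the odd dimension is q exactly when dim A₀ = dim A₀/Ann(P)
(`Parameters.oddKrullDim_eq_iff`). Since I lies in every prime, dim A₀ = dim A₀/I ≤ r.

Every nonzero element of the source of κ has a nonzero multiple of the form f ⊗ top, so injectivity
need only be tested on these: for a form F of degree n, F(x)P ∈ 𝔪^(n+q+1) must force the
coefficients of F into 𝔪₀ (`Parameters.kappa_injective_iff`).

The bridge to dimension is quasi-regularity. Let r elements generate the maximal ideal of a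
Noetherian local ring. They are quasi-regular if and only if the dimension is at least r, and then
the ring is a domain (`isQuasiRegular_of_le_ringKrullDim`, `IsQuasiRegular.le_ringKrullDim`,
`IsQuasiRegular.isDomain`).

If A is regular, then A₀/I is a domain of dimension r; an annihilator of P strictly larger than I
would lower the dimension, so Ann(P) = I. As 𝔪^M ⊆ ∑ (x)^(M-j) A₁^j, a comparison of odd degrees
turns F(x)P ∈ 𝔪^(n+q+1) into F(x)P ∈ (x)^(n+1) P (`IsAnticommuting.mem_smul_pow_of_mem_iSup`).
Cancelling P modulo I leaves the quasi-regularity of x in A₀/I. Conversely, the criterion makes x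
quasi-regular modulo Ann(P), whence r ≤ dim A₀/Ann(P) ≤ dim A₀ ≤ r. -/

namespace SuperRing

universe u

/-! ### Quasi-regular families in commutative rings. -/

section QuasiRegular

open MvPolynomial

variable {S : Type*} [CommRing S] {ι : Type*}

/-- A family `x` is quasi-regular if every form of degree `n` whose value at `x` lies in
`(x) ^ (n + 1)` has all its coefficients in `(x)`. -/
def IsQuasiRegular (x : ι → S) : Prop :=
  ∀ (n : ℕ) (F : MvPolynomial ι S), F.IsHomogeneous n →
    eval x F ∈ Ideal.span (Set.range x) ^ (n + 1) → ∀ α, F.coeff α ∈ Ideal.span (Set.range x)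

theorem eval_mem_mul_pow {x : ι → S} {I : Ideal S} {n : ℕ} {F : MvPolynomial ι S}
    (hF : F.IsHomogeneous n) (h : ∀ α, F.coeff α ∈ I) :
    eval x F ∈ I * Ideal.span (Set.range x) ^ n := by
  rw [F.as_sum, map_sum]
  refine Ideal.sum_mem _ fun α hα => ?_
  rw [show monomial α (coeff α F) = C (coeff α F) * monomial α 1 by simp [C_mul_monomial],
    map_mul, eval_C]
  refine Ideal.mul_mem_mul (h α) ((Ideal.mem_span_pow_iff_exists_isHomogeneous x _).2
    ⟨_, ?_, rfl⟩)
  exact isHomogeneous_monomial _ (by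
    have := hF (mem_support_iff.1 hα)
    rwa [Pi.one_def, ← Finsupp.degree_eq_weight_one] at this)

theorem eval_mem_pow {x : ι → S} {n : ℕ} {F : MvPolynomial ι S} (hF : F.IsHomogeneous n) :
    eval x F ∈ Ideal.span (Set.range x) ^ n :=
  (Ideal.mem_span_pow_iff_exists_isHomogeneous x _).2 ⟨F, hF, rfl⟩

theorem eval_mk_map (I : Ideal S) (x : ι → S) (F : MvPolynomial ι S) :
    eval (fun i => Ideal.Quotient.mk I (x i)) (map (Ideal.Quotient.mk I) F) =
      Ideal.Quotient.mk I (eval x F) := by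
  rw [eval_map, ← eval₂_id (p := F), eval₂_comp_left]
  rfl

theorem span_range_mk (I : Ideal S) (x : ι → S) :
    Ideal.span (Set.range fun i => Ideal.Quotient.mk I (x i)) =
      (Ideal.span (Set.range x)).map (Ideal.Quotient.mk I) := by
  rw [Ideal.map_span, ← Set.range_comp]
  rfl

theorem exists_isHomogeneous_map_eq {T : Type*} [CommRing T] {f : S →+* T}
    (hf : Function.Surjective f) {n : ℕ} {F : MvPolynomial ι T} (hF : F.IsHomogeneous n) :
    ∃ G : MvPolynomial ι S, G.IsHomogeneous n ∧ map f G = F := by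
  obtain ⟨G, rfl⟩ := map_surjective f hf F
  refine ⟨homogeneousComponent n G, homogeneousComponent_isHomogeneous n G, ?_⟩
  ext α
  by_cases h : α.degree = n
  · simp [coeff_map, coeff_homogeneousComponent, h]
  · rw [coeff_map, coeff_homogeneousComponent, if_neg h, map_zero,
      hF.coeff_eq_zero h]

/-- Forms over S/I lift to forms over S of the same degree, so quasi-regularity modulo I can be used
without leaving S. -/
theorem isQuasiRegular_mk_iff (I : Ideal S) (x : ι → S) :
    IsQuasiRegular (fun i => Ideal.Quotient.mk I (x i)) ↔
      ∀ (n : ℕ) (F : MvPolynomial ι S), F.IsHomogeneous n →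
        eval x F ∈ Ideal.span (Set.range x) ^ (n + 1) ⊔ I →
        ∀ α, F.coeff α ∈ Ideal.span (Set.range x) ⊔ I := by
  constructor
  · intro h n F hF hx α
    rw [← Ideal.mem_quotient_iff_mem_sup] at hx ⊢
    rw [Ideal.map_pow, ← span_range_mk, ← eval_mk_map] at hx
    have := h n _ (hF.map _) hx α
    rwa [span_range_mk, coeff_map] at this
  · intro h n F hF hx α
    obtain ⟨G, hG, rfl⟩ := exists_isHomogeneous_map_eq Ideal.Quotient.mk_surjective hF
    rw [eval_mk_map, span_range_mk, ← Ideal.map_pow, Ideal.mem_quotient_iff_mem_sup] at hx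
    rw [span_range_mk, coeff_map, Ideal.mem_quotient_iff_mem_sup]
    exact h n G hG hx α

theorem IsQuasiRegular.of_mk {I : Ideal S} {x : ι → S}
    (h : IsQuasiRegular (fun i => Ideal.Quotient.mk I (x i))) (hI : I ≤ Ideal.span (Set.range x)) :
    IsQuasiRegular x := by
  intro n F hF hx α
  have := (isQuasiRegular_mk_iff I x).1 h n F hF (Ideal.mem_sup_left hx) α
  rwa [sup_eq_left.2 hI] at this

/-- Krull's intersection theorem for the module S/J. -/
theorem mem_of_forall_mem_sup_pow [IsNoetherianRing S] {I J : Ideal S}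
    (hI : I ≤ (⊥ : Ideal S).jacobson)
    {a : S} (h : ∀ n, a ∈ J ⊔ I ^ n) : a ∈ J := by
  have key := Ideal.iInf_pow_smul_eq_bot_of_le_jacobson (M := S ⧸ J) I hI
  rw [← Ideal.Quotient.eq_zero_iff_mem, ← Submodule.mem_bot S, ← key, Submodule.mem_iInf]
  intro n
  obtain ⟨b, hb, c, hc, rfl⟩ := Submodule.mem_sup.1 (h n)
  rw [map_add, Ideal.Quotient.eq_zero_iff_mem.2 hb, zero_add]
  have := Submodule.smul_mem_smul hc (Submodule.mem_top (x := (1 : S ⧸ J)))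
  rwa [Algebra.smul_def, mul_one] at this

/-- If `x` is quasi-regular modulo `I`, then `I ∩ (x) ^ k = I (x) ^ k`. -/
theorem inf_pow_le_mul_pow [IsNoetherianRing S] {I : Ideal S} {x : ι → S}
    (hx : Ideal.span (Set.range x) ≤ (⊥ : Ideal S).jacobson)
    (h : IsQuasiRegular (fun i => Ideal.Quotient.mk I (x i))) (k : ℕ) :
    I ⊓ Ideal.span (Set.range x) ^ k ≤ I * Ideal.span (Set.range x) ^ k := by
  set b := Ideal.span (Set.range x) with hb
  -- An element F(x) of I vanishes modulo I, so the coefficients of F lie in b + I and F(x) ∈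
  -- b^(n+1) + I b^n. The part in I b^n is split off; what remains is still in I. Iteration and
  -- Krull's intersection theorem finish.
  have step : ∀ n, I ⊓ b ^ n ≤ I * b ^ n ⊔ I ⊓ b ^ (n + 1) := by
    rintro n a ⟨ha, han⟩
    obtain ⟨F, hF, rfl⟩ := (Ideal.mem_span_pow_iff_exists_isHomogeneous x _).1 han
    have h1 := (isQuasiRegular_mk_iff I x).1 h n F hF (Ideal.mem_sup_right ha)
    have h2 := eval_mem_mul_pow (x := x) hF h1
    rw [Ideal.sup_mul, sup_comm, ← pow_succ'] at h2
    generalize eval x F = a at *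
    obtain ⟨c, hc, d, hd, rfl⟩ := Submodule.mem_sup.1 h2
    have hc' : c ∈ I := (Ideal.mul_le_inf hc).1
    exact Submodule.add_mem_sup hc ⟨(I.add_mem_iff_right hc').1 ha, hd⟩
  have iter : ∀ n, I ⊓ b ^ k ≤ I * b ^ k ⊔ I ⊓ b ^ (k + n) := by
    intro n
    induction n with
    | zero => exact le_sup_right
    | succ n ih =>
      refine ih.trans (sup_le le_sup_left ((step _).trans (sup_le_sup ?_ le_rfl)))
      exact Ideal.mul_mono_right (Ideal.pow_le_pow_right (Nat.le_add_right _ _))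
  intro a ha
  refine mem_of_forall_mem_sup_pow hx fun n => ?_
  exact (sup_le_sup le_rfl (inf_le_right.trans (Ideal.pow_le_pow_right
    (Nat.le_add_left n k)))) (iter n ha)

end QuasiRegular

/-! ### Orders of elements and the domain property. -/

section QuasiRegularLocal

open MvPolynomial IsLocalRing

universe v

theorem exists_mem_pow_notMem_pow {S : Type*} [CommRing S] {I : Ideal S} {a : S} {k : ℕ}
    (h : a ∉ I ^ k) : ∃ j < k, a ∈ I ^ j ∧ a ∉ I ^ (j + 1) := by
  classical
  have hex : ∃ k, a ∉ I ^ k := ⟨k, h⟩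
  have h0 : Nat.find hex ≠ 0 := fun h0 => by
    have := Nat.find_spec hex
    rw [h0, pow_zero, Ideal.one_eq_top] at this
    exact this trivial
  obtain ⟨j, hj⟩ := Nat.exists_eq_succ_of_ne_zero h0
  refine ⟨j, ?_, ?_, ?_⟩
  · have := Nat.find_min' hex h
    omega
  · by_contra hn
    have := Nat.find_min' hex hn
    omega
  · have := Nat.find_spec hex
    rwa [hj] at this

/-- Orders add because initial forms multiply without cancellation: the extension of the prime (x)
to the polynomial ring is again prime. -/
theorem IsQuasiRegular.mul_notMem_pow {S ι : Type*} [CommRing S] {x : ι → S}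
    (hx : IsQuasiRegular x) (hp : (Ideal.span (Set.range x)).IsPrime) {i j : ℕ} {a b : S}
    (ha : a ∈ Ideal.span (Set.range x) ^ i) (ha' : a ∉ Ideal.span (Set.range x) ^ (i + 1))
    (hb : b ∈ Ideal.span (Set.range x) ^ j) (hb' : b ∉ Ideal.span (Set.range x) ^ (j + 1)) :
    a * b ∉ Ideal.span (Set.range x) ^ (i + j + 1) := by
  set I := Ideal.span (Set.range x) with hI
  obtain ⟨F, hF, rfl⟩ := (Ideal.mem_span_pow_iff_exists_isHomogeneous x _).1 ha
  obtain ⟨G, hG, rfl⟩ := (Ideal.mem_span_pow_iff_exists_isHomogeneous x _).1 hb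
  intro h
  rw [← map_mul] at h
  have key := hx _ _ (hF.mul hG) h
  rw [← hI, ← mem_map_C_iff] at key
  have : (I.map (C : S →+* MvPolynomial ι S)).IsPrime := by
    have := RingHom.ker_isPrime (map (σ := ι) (Ideal.Quotient.mk I))
    rwa [ker_map, Ideal.mk_ker] at this
  rcases this.mem_or_mem key with h | h <;> rw [mem_map_C_iff] at h
  · have := eval_mem_mul_pow (x := x) hF h
    rw [← hI, ← pow_succ'] at this
    exact ha' this
  · have := eval_mem_mul_pow (x := x) hG h
    rw [← hI, ← pow_succ'] at this
    exact hb' this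

open Classical in
theorem IsQuasiRegular.notMem_sq {S ι : Type*} [CommRing S] {x : ι → S}
    (hx : IsQuasiRegular x) (hp : (Ideal.span (Set.range x)).IsPrime) (i : ι) :
    x i ∉ Ideal.span (Set.range x) ^ 2 := by
  intro h
  have := hx 1 (X i) (isHomogeneous_X _ _) (by rwa [eval_X]) (Finsupp.single i 1)
  rw [coeff_X, if_pos rfl] at this
  exact hp.one_notMem this

variable {S : Type v} [CommRing S] [IsLocalRing S]

theorem le_jacobson_bot {I : Ideal S} (hI : I ≤ maximalIdeal S) : I ≤ (⊥ : Ideal S).jacobson := by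
  rwa [jacobson_eq_maximalIdeal ⊥ bot_ne_top]

theorem isLocalRing_quotient {I : Ideal S} (hI : I ≤ maximalIdeal S) : IsLocalRing (S ⧸ I) :=
  have : Nontrivial (S ⧸ I) := Ideal.Quotient.nontrivial_iff.2
    (ne_top_of_le_ne_top (maximalIdeal.isMaximal S).ne_top hI)
  .of_surjective' _ Ideal.Quotient.mk_surjective

theorem maximalIdeal_quotient {I : Ideal S} (hI : I ≤ maximalIdeal S) [IsLocalRing (S ⧸ I)] :
    maximalIdeal (S ⧸ I) = (maximalIdeal S).map (Ideal.Quotient.mk I) := by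
  refine (eq_maximalIdeal ?_).symm
  refine (Ideal.map_eq_top_or_isMaximal_of_surjective _ Ideal.Quotient.mk_surjective
    (maximalIdeal.isMaximal S)).resolve_left fun h => ?_
  have h1 : (1 : S ⧸ I) ∈ (maximalIdeal S).map (Ideal.Quotient.mk I) := h ▸ trivial
  rw [← map_one (Ideal.Quotient.mk I), Ideal.mem_quotient_iff_mem_sup, sup_eq_left.2 hI] at h1
  exact (maximalIdeal.isMaximal S).ne_top ((Ideal.eq_top_iff_one _).2 h1)

theorem ringKrullDim_le_of_maximalIdeal_eq_span [IsNoetherianRing S] {r : ℕ} {x : Fin r → S}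
    (hx : Ideal.span (Set.range x) = maximalIdeal S) : ringKrullDim S ≤ r := by
  refine (ringKrullDim_le_spanFinrank_maximalIdeal S).trans ?_
  rw [← hx]
  have h := (Submodule.spanFinrank_span_le_ncard_of_finite (R := S) (Set.finite_range x)).trans
    (Set.image_univ (f := x) ▸ Set.ncard_image_le Set.finite_univ)
  rw [Set.ncard_univ, Nat.card_eq_fintype_card, Fintype.card_fin] at h
  exact_mod_cast h

variable [IsNoetherianRing S]

/-- A Noetherian local ring whose maximal ideal is generated by a quasi-regular family is a
domain. -/
theorem IsQuasiRegular.isDomain {ι : Type*} {x : ι → S} (hx : IsQuasiRegular x)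
    (hm : Ideal.span (Set.range x) = maximalIdeal S) : IsDomain S := by
  have hp : (Ideal.span (Set.range x)).IsPrime := hm ▸ (maximalIdeal.isMaximal S).isPrime
  -- By Krull's intersection theorem a nonzero element has a finite order. Orders add, so a product
  -- of nonzero elements has finite order too and cannot vanish.
  have ord : ∀ a : S, a ≠ 0 → ∃ j, a ∈ Ideal.span (Set.range x) ^ j ∧
      a ∉ Ideal.span (Set.range x) ^ (j + 1) := by
    intro a ha
    by_contra! hn
    refine ha ((Submodule.mem_bot S).1 (mem_of_forall_mem_sup_pow (le_jacobson_bot hm.le)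
      (fun n => Ideal.mem_sup_right ?_)))
    by_contra h
    obtain ⟨j, -, h1, h2⟩ := exists_mem_pow_notMem_pow h
    exact h2 (hn j h1)
  have : NoZeroDivisors S := ⟨fun {a b} hab => by
    by_contra! h
    obtain ⟨i, h1, h2⟩ := ord a h.1
    obtain ⟨j, h3, h4⟩ := ord b h.2
    exact hx.mul_notMem_pow hp h1 h2 h3 h4 (hab ▸ zero_mem _)⟩
  exact NoZeroDivisors.to_isDomain S

end QuasiRegularLocal

/-! ### Splitting off the first variable. -/

section Fin

open MvPolynomial

variable {S : Type*} [CommRing S] {r : ℕ}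

theorem span_range_eq_sup_tail (x : Fin (r + 1) → S) :
    Ideal.span (Set.range x) =
      Ideal.span (Set.range fun i : Fin r => x i.succ) ⊔ Ideal.span {x 0} := by
  rw [← Ideal.span_union, Set.union_singleton, ← Fin.range_cons]
  congr 2
  exact (Fin.cons_self_tail x).symm

theorem eval_rename_succ (x : Fin (r + 1) → S) (F : MvPolynomial (Fin r) S) :
    eval x (rename Fin.succ F) = eval (fun i : Fin r => x i.succ) F := by
  rw [eval_rename]
  rfl

theorem map_mk_span_range_tail (x : Fin (r + 1) → S) :
    Ideal.span (Set.range fun i : Fin r => Ideal.Quotient.mk (Ideal.span {x 0}) (x i.succ)) =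
      (Ideal.span (Set.range x)).map (Ideal.Quotient.mk (Ideal.span {x 0})) := by
  rw [span_range_mk, span_range_eq_sup_tail x, Ideal.map_sup, Ideal.map_quotient_self, sup_bot_eq]

theorem exists_eq_X_mul_add_rename {n : ℕ} {F : MvPolynomial (Fin (r + 1)) S}
    (hF : F.IsHomogeneous (n + 1)) :
    ∃ (G : MvPolynomial (Fin (r + 1)) S) (H : MvPolynomial (Fin r) S),
      G.IsHomogeneous n ∧ H.IsHomogeneous (n + 1) ∧ F = X 0 * G + rename Fin.succ H := by
  have hdeg : ∀ {k : ℕ} {α : Fin (r + 1) →₀ ℕ}, Finsupp.weight 1 α = k ↔ α.degree = k := by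
    intro k α
    rw [Finsupp.degree_eq_weight_one, Pi.one_def]
  have hM : (F.modMonomial (Finsupp.single 0 1)).IsHomogeneous (n + 1) := by
    intro α hα
    by_cases h : Finsupp.single 0 1 ≤ α
    · exact absurd (coeff_modMonomial_of_le F h) hα
    · rw [coeff_modMonomial_of_not_le F h] at hα
      exact hF hα
  obtain ⟨H, hH⟩ := exists_rename_eq_of_vars_subset_range (F.modMonomial (Finsupp.single 0 1))
    (Fin.succ (n := r)) (Fin.succ_injective r) (by
      intro i hi
      obtain ⟨α, hα, hiα⟩ := (mem_vars_iff_mem_support i).1 hi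
      by_cases h : Finsupp.single 0 1 ≤ α
      · exact absurd (coeff_modMonomial_of_le F h) (mem_support_iff.1 hα)
      · refine Fin.exists_succ_eq.2 ?_
        rintro rfl
        rw [Finsupp.single_le_iff, Nat.one_le_iff_ne_zero] at h
        exact h (Finsupp.mem_support_iff.1 hiα))
  refine ⟨F.divMonomial (Finsupp.single 0 1), H, ?_, ?_, ?_⟩
  · intro α hα
    rw [coeff_divMonomial] at hα
    have := hdeg.1 (hF hα)
    rw [map_add, Finsupp.degree_single] at this
    exact hdeg.2 (by omega)
  · rw [← IsHomogeneous.rename_isHomogeneous_iff (Fin.succ_injective r), hH]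
    exact hM
  · rw [hH, divMonomial_add_modMonomial_single]

end Fin

/-! ### Quasi-regularity and Krull dimension. -/

section Dimension

open MvPolynomial IsLocalRing

universe v

/-- A Noetherian local ring whose maximal ideal is generated by a quasi-regular family of length
`r` has dimension at least `r`. -/
theorem IsQuasiRegular.le_ringKrullDim {r : ℕ} : ∀ {S : Type v} [CommRing S] [IsLocalRing S]
    [IsNoetherianRing S] {x : Fin r → S}, IsQuasiRegular x →
    Ideal.span (Set.range x) = maximalIdeal S → (r : WithBot ℕ∞) ≤ ringKrullDim S := by
  induction r with
  | zero => intro S _ _ _ x _ _; exact_mod_cast ringKrullDim_nonneg_of_nontrivial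
  | succ r ih =>
    intro S _ _ _ x hx hm
    have hdom := hx.isDomain hm
    have hp : (Ideal.span (Set.range x)).IsPrime := hm ▸ (maximalIdeal.isMaximal S).isPrime
    have hx0 : x 0 ≠ 0 := fun h => hx.notMem_sq hp 0 (h ▸ zero_mem _)
    have h0 : x 0 ∈ Ideal.span (Set.range x) := Ideal.subset_span ⟨0, rfl⟩
    have hle : Ideal.span {x 0} ≤ maximalIdeal S := by
      rw [Ideal.span_singleton_le_iff_mem, ← hm]; exact h0
    have := isLocalRing_quotient hle
    -- The element `x 0` has order exactly one and orders add, so if b had order j < k, the product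
    -- would have order j + 1 ≤ k.
    have hcolon : ∀ {k : ℕ} {b : S}, x 0 * b ∈ Ideal.span (Set.range x) ^ (k + 1) →
        b ∈ Ideal.span (Set.range x) ^ k := by
      intro k b hb
      by_contra hn
      obtain ⟨j, hj, h1, h2⟩ := exists_mem_pow_notMem_pow hn
      refine hx.mul_notMem_pow hp (i := 1) (by rwa [pow_one]) (hx.notMem_sq hp 0) h1 h2 ?_
      exact Ideal.pow_le_pow_right (by omega) hb
    have hq : IsQuasiRegular fun i : Fin r => Ideal.Quotient.mk (Ideal.span {x 0}) (x i.succ) := by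
      rw [isQuasiRegular_mk_iff]
      intro n F hF hev α
      rw [← span_range_eq_sup_tail x]
      obtain ⟨g, hg, c, hc, e⟩ := Submodule.mem_sup.1 hev
      obtain ⟨b, rfl⟩ := Ideal.mem_span_singleton'.1 hc
      rw [mul_comm] at e
      have hg' : g ∈ Ideal.span (Set.range x) ^ (n + 1) := by
        refine Ideal.pow_right_mono ?_ _ hg
        rw [span_range_eq_sup_tail x]; exact le_sup_left
      rw [← eval_rename_succ] at e
      have hF' : (rename Fin.succ F : MvPolynomial (Fin (r + 1)) S).IsHomogeneous n :=
        hF.rename_isHomogeneous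
      cases n with
      -- For a constant form the exponent of b cannot be lowered by `hcolon`, so the single
      -- coefficient is read off directly.
      | zero =>
        rw [zero_add, pow_one] at hg'
        have hc : F = C (coeff 0 F) := by
          rw [← totalDegree_eq_zero_iff_eq_C]
          exact (totalDegree_zero_iff_isHomogeneous _).2 hF
        rw [hc, rename_C, eval_C] at e
        rw [hc, coeff_C]
        split_ifs with h
        · rw [← e]; exact add_mem hg' (Ideal.mul_mem_right _ _ h0)
        · exact zero_mem _
      | succ n =>
        have hb : b ∈ Ideal.span (Set.range x) ^ n := by
          refine hcolon ?_
          rw [← add_sub_cancel_left g (x 0 * b), e]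
          exact sub_mem (eval_mem_pow hF') (Ideal.pow_le_pow_right (Nat.le_succ _) hg')
        obtain ⟨B, hB, rfl⟩ := (Ideal.mem_span_pow_iff_exists_isHomogeneous x _).1 hb
        have hB' : (X 0 * B).IsHomogeneous (n + 1) := by
          simpa only [add_comm] using (isHomogeneous_X S 0).mul hB
        -- With b = B(x), the form F - X₀B takes the value g in (x)^(n+2). In monomials free of X₀
        -- its coefficients are those of F.
        have := hx _ _ (hF'.sub hB') (by
          rw [map_sub, map_mul, eval_X, ← e, add_sub_cancel_right]; exact hg')
          (α.mapDomain Fin.succ)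
        rw [coeff_sub, coeff_rename_mapDomain _ (Fin.succ_injective r), coeff_X_mul',
          if_neg, sub_zero] at this
        · exact this
        · rw [Finsupp.notMem_support_iff]
          exact Finsupp.mapDomain_of_notMem_range _ _ (by simp)
    have h1 := ih hq (by rw [map_mk_span_range_tail, hm, maximalIdeal_quotient hle])
    refine le_trans ?_ (ringKrullDim_quotient_succ_le_of_nonZeroDivisor
      (mem_nonZeroDivisors_of_ne_zero hx0))
    rw [Nat.cast_add, Nat.cast_one]
    exact add_le_add_left h1 1

/-- The smallest prime of a chain of length r serves as p, since the whole chain lies above it. -/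
theorem exists_isPrime_le_ringKrullDim_quotient {S : Type v} [CommRing S] {r : ℕ}
    (h : (r : WithBot ℕ∞) ≤ ringKrullDim S) :
    ∃ p : Ideal S, p.IsPrime ∧ (r : WithBot ℕ∞) ≤ ringKrullDim (S ⧸ p) := by
  obtain ⟨l, hl⟩ := Order.le_krullDim_iff.1 h
  refine ⟨l.head.asIdeal, l.head.isPrime, ?_⟩
  rw [ringKrullDim_quotient]
  have e : (PrimeSpectrum.zeroLocus (R := S) l.head.asIdeal) = Set.Ici l.head := by
    ext q; rfl
  rw [e, ← Order.coheight_eq_krullDim_Ici, ← hl]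
  exact_mod_cast Order.length_le_coheight le_rfl

/-- Write F = X₀G + H with H free of X₀. Modulo `x 0` only H survives, so its coefficients lie in m
by the hypothesis on the tail; then H(x) is negligible, and G is handled by induction on the degree
once `x 0` can be cancelled (`hcolon`). The cancellation rests on m^(n+1) ⊆ (x₀)m^n + b^(n+1), on
(x₀) ∩ b^(n+1) ⊆ (x₀)b^(n+1), and on D being a domain. -/
theorem isQuasiRegular_of_tail {D : Type v} [CommRing D] [IsDomain D] [IsLocalRing D]
    [IsNoetherianRing D] {r : ℕ} {x : Fin (r + 1) → D} (hx0 : x 0 ≠ 0)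
    (hm : Ideal.span (Set.range x) = maximalIdeal D)
    (hq : IsQuasiRegular fun i : Fin r => Ideal.Quotient.mk (Ideal.span {x 0}) (x i.succ)) :
    IsQuasiRegular x := by
  set b := Ideal.span (Set.range fun i : Fin r => x i.succ) with hb
  set m := Ideal.span (Set.range x) with hm_def
  have hsup : m = b ⊔ Ideal.span {x 0} := span_range_eq_sup_tail x
  have h0 : x 0 ∈ m := Ideal.subset_span ⟨0, rfl⟩
  have hbm : b ≤ m := hsup ▸ le_sup_left
  have hpow : ∀ n, m ^ (n + 1) ≤ Ideal.span {x 0} * m ^ n ⊔ b ^ (n + 1) := by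
    intro n
    induction n with
    | zero => rw [pow_zero, mul_one, zero_add, pow_one, pow_one, hsup, sup_comm]
    | succ n ih =>
      rw [pow_succ' m (n + 1)]
      have e : m * m ^ (n + 1) = Ideal.span {x 0} * m ^ (n + 1) ⊔ b * m ^ (n + 1) := by
        rw [← Ideal.sup_mul, sup_comm, ← hsup]
      rw [e]
      refine sup_le le_sup_left ((Ideal.mul_mono_right ih).trans ?_)
      rw [Ideal.mul_sup, ← pow_succ' b]
      refine sup_le_sup ?_ le_rfl
      rw [mul_left_comm, pow_succ' m]
      exact Ideal.mul_mono_right (Ideal.mul_mono_left hbm)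
  have hcolon : ∀ {n : ℕ} {a : D}, x 0 * a ∈ m ^ (n + 1) → a ∈ m ^ n := by
    intro n a ha
    obtain ⟨c, hc, d, hd, e⟩ := Submodule.mem_sup.1 (hpow n ha)
    have hd' : d ∈ Ideal.span {x 0} * m ^ n := by
      have h1 : d ∈ Ideal.span {x 0} ⊓ b ^ (n + 1) := by
        refine ⟨?_, hd⟩
        rw [← add_sub_cancel_left c d, e]
        exact sub_mem (Ideal.mul_mem_right _ _ (Ideal.mem_span_singleton_self _))
          (Ideal.mul_le_inf hc).1
      refine Ideal.mul_mono_right ?_ (inf_pow_le_mul_pow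
        (le_jacobson_bot (hbm.trans hm.le)) hq (n + 1) h1)
      exact (Ideal.pow_right_mono hbm _).trans (Ideal.pow_le_pow_right (Nat.le_succ _))
    have h2 : x 0 * a ∈ Ideal.span {x 0} * m ^ n := e ▸ add_mem hc hd'
    obtain ⟨c', hc', h3⟩ := Ideal.mem_span_singleton_mul.1 h2
    rwa [← mul_left_cancel₀ hx0 h3]
  intro n
  induction n with
  | zero =>
    intro F hF hev α
    rw [zero_add, pow_one] at hev
    have hc : F = C (coeff 0 F) := by
      rw [← totalDegree_eq_zero_iff_eq_C]
      exact (totalDegree_zero_iff_isHomogeneous _).2 hF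
    rw [hc, eval_C] at hev
    rw [hc, coeff_C]
    split_ifs
    · exact hev
    · exact zero_mem _
  | succ n ih =>
    intro F hF hev
    obtain ⟨G, H, hG, hH, rfl⟩ := exists_eq_X_mul_add_rename hF
    rw [map_add, map_mul, eval_X, eval_rename_succ] at hev
    have hHc : ∀ α, H.coeff α ∈ m := by
      have h1 := (isQuasiRegular_mk_iff (Ideal.span {x 0}) fun i : Fin r => x i.succ).1 hq _ H hH
      rw [← hb, ← hsup] at h1
      refine h1 ?_
      have h2 := hpow (n + 1) hev
      have h3 : Ideal.span {x 0} * m ^ (n + 1) ≤ Ideal.span {x 0} :=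
        Ideal.mul_le_inf.trans inf_le_left
      rw [sup_comm]
      have h4 := sup_le_sup_right h3 (b ^ (n + 1 + 1)) h2
      exact (Submodule.add_mem_iff_right _ (Ideal.mem_sup_left
        (Ideal.mul_mem_right _ _ (Ideal.mem_span_singleton_self _)))).1 h4
    have hHe : eval (fun i : Fin r => x i.succ) H ∈ m ^ (n + 1 + 1) := by
      have := eval_mem_mul_pow hH hHc (x := fun i : Fin r => x i.succ)
      rw [pow_succ']
      exact Ideal.mul_mono_right (Ideal.pow_right_mono hbm _) this
    have hGc := ih G hG (hcolon ((Submodule.add_mem_iff_left _ hHe).1 hev))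
    have hGc' := mem_map_C_iff.2 hGc
    rw [← mem_map_C_iff]
    refine add_mem (Ideal.mul_mem_left _ _ hGc') (mem_map_C_iff.2 fun α => ?_)
    by_cases h : ∃ u : Fin r →₀ ℕ, u.mapDomain Fin.succ = α
    · obtain ⟨u, rfl⟩ := h
      rw [coeff_rename_mapDomain _ (Fin.succ_injective r)]
      exact hHc u
    · rw [coeff_rename_eq_zero _ _ _ fun u hu => absurd ⟨u, hu⟩ h]
      exact zero_mem _

/-- If the maximal ideal of a Noetherian local ring of dimension `r` is generated by `r` elements,
then these elements are quasi-regular. -/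
theorem isQuasiRegular_of_le_ringKrullDim {r : ℕ} : ∀ {S : Type v} [CommRing S] [IsLocalRing S]
    [IsNoetherianRing S] {x : Fin r → S}, (r : WithBot ℕ∞) ≤ ringKrullDim S →
    Ideal.span (Set.range x) = maximalIdeal S → IsQuasiRegular x := by
  induction r with
  | zero =>
    intro S _ _ _ x _ hm n F hF hev α
    have := Ideal.pow_le_self n.succ_ne_zero hev
    rw [eq_C_of_isEmpty F, eval_C] at this
    rwa [Subsingleton.elim α 0]
  | succ r ih =>
    intro S _ _ _ x hdim hm
    -- Passing to S/p makes the ring a domain without losing dimension; quasi-regularity comes back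
    -- because p ⊆ (x).
    obtain ⟨p, hp, hdimp⟩ := exists_isPrime_le_ringKrullDim_quotient hdim
    have hpm := le_maximalIdeal hp.ne_top
    refine IsQuasiRegular.of_mk (I := p) ?_ (hm ▸ hpm)
    have hloc := isLocalRing_quotient hpm
    have hm' : Ideal.span (Set.range fun i => Ideal.Quotient.mk p (x i)) = maximalIdeal (S ⧸ p) := by
      rw [span_range_mk, hm, maximalIdeal_quotient hpm]
    generalize (fun i => Ideal.Quotient.mk p (x i)) = y at *
    -- Otherwise r elements would generate a maximal ideal in dimension at least r + 1.
    have hy0 : y 0 ≠ 0 := by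
      intro h0
      have h := span_range_eq_sup_tail y
      rw [h0, Ideal.span_singleton_zero, sup_bot_eq, hm'] at h
      have h2 := hdimp.trans (ringKrullDim_le_of_maximalIdeal_eq_span h.symm)
      norm_cast at h2
      omega
    have hle : Ideal.span {y 0} ≤ maximalIdeal (S ⧸ p) := by
      rw [Ideal.span_singleton_le_iff_mem, ← hm']
      exact Ideal.subset_span ⟨0, rfl⟩
    have := isLocalRing_quotient hle
    refine isQuasiRegular_of_tail hy0 hm' (ih ?_ ?_)
    · have h := Module.ringKrullDim_quotient_add_one_of_mem_nonZeroDivisors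
        (mem_nonZeroDivisors_of_ne_zero hy0) (p := maximalIdeal (S ⧸ p))
        maximalIdeal_height_eq_ringKrullDim (hle (Ideal.mem_span_singleton_self _))
      rw [← h, Nat.cast_add, Nat.cast_one] at hdimp
      exact (ENat.WithBot.add_le_add_one_right_iff).1 hdimp
    · rw [map_mk_span_range_tail, hm', maximalIdeal_quotient hle]

end Dimension

/-! ### Products of anticommuting elements. -/

section Anticommuting

open scoped Pointwise

variable {B : Type*} [Ring B]

/-- A family of pairwise anticommuting elements with zero squares. -/
structure IsAnticommuting {ι : Type*} (θ : ι → B) : Prop where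
  anti : ∀ i j, θ i * θ j = -(θ j * θ i)
  sq : ∀ i, θ i * θ i = 0

/-- The product of the `θ i`, `i ∈ s`, in some order. -/
noncomputable def finsetProd {ι : Type*} (θ : ι → B) (s : Finset ι) : B := (s.toList.map θ).prod

namespace IsAnticommuting

section General

variable {ι : Type*} {θ : ι → B}

theorem prod_perm (h : IsAnticommuting θ) {l l' : List ι} (p : l.Perm l') :
    (l.map θ).prod = (l'.map θ).prod ∨ (l.map θ).prod = -(l'.map θ).prod := by
  induction p with
  | nil => exact Or.inl rfl
  | cons i _ ih =>
    simp only [List.map_cons, List.prod_cons]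
    rcases ih with e | e
    · exact Or.inl (by rw [e])
    · exact Or.inr (by rw [e, mul_neg])
  | swap i j l =>
    simp only [List.map_cons, List.prod_cons]
    exact Or.inr (by rw [← mul_assoc, h.anti, neg_mul, mul_assoc])
  | trans _ _ ih ih' =>
    rcases ih with e | e <;> rcases ih' with e' | e' <;> simp [e, e']

theorem prod_eq_zero_of_not_nodup (h : IsAnticommuting θ) {l : List ι} (hl : ¬ l.Nodup) :
    (l.map θ).prod = 0 := by
  rw [List.nodup_iff_sublist] at hl
  push Not at hl
  obtain ⟨i, hi⟩ := hl
  obtain ⟨t, ht⟩ := hi.exists_perm_append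
  have : ((([i, i] ++ t).map θ).prod) = 0 := by
    simp [← mul_assoc, h.sq]
  rcases h.prod_perm ht with e | e <;> simp only [e, this, neg_zero]

theorem prod_eq_finsetProd (h : IsAnticommuting θ) [DecidableEq ι] {l : List ι} (hl : l.Nodup) :
    (l.map θ).prod = finsetProd θ l.toFinset ∨ (l.map θ).prod = -finsetProd θ l.toFinset :=
  h.prod_perm (List.toFinset_toList hl).symm

theorem finsetProd_mul_eq_zero (h : IsAnticommuting θ) {s t : Finset ι} (hst : ¬ Disjoint s t) :
    finsetProd θ s * finsetProd θ t = 0 := by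
  rw [finsetProd, finsetProd, ← List.prod_append, ← List.map_append]
  refine h.prod_eq_zero_of_not_nodup fun hn => hst ?_
  rw [Finset.disjoint_left]
  intro i hi hi'
  exact List.disjoint_of_nodup_append hn (Finset.mem_toList.2 hi) (Finset.mem_toList.2 hi')

theorem finsetProd_mul_of_disjoint (h : IsAnticommuting θ) [DecidableEq ι]
    {s t : Finset ι} (hst : Disjoint s t) :
    finsetProd θ s * finsetProd θ t = finsetProd θ (s ∪ t) ∨
      finsetProd θ s * finsetProd θ t = -finsetProd θ (s ∪ t) := by
  have hn : (s.toList ++ t.toList).Nodup := List.Nodup.append s.nodup_toList t.nodup_toList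
    fun i hi hi' => Finset.disjoint_left.1 hst (Finset.mem_toList.1 hi) (Finset.mem_toList.1 hi')
  have := h.prod_eq_finsetProd hn
  rwa [List.map_append, List.prod_append, List.toFinset_append, Finset.toList_toFinset,
    Finset.toList_toFinset] at this

/-- A set t disjoint from the complement of s lies in s, and its size leaves only t = s.
Multiplication by the complementary product thus isolates the coefficient of s among all terms of at
least its degree. -/
theorem finsetProd_mul_compl_of_ne (h : IsAnticommuting θ) [DecidableEq ι] [Fintype ι] {s t : Finset ι}
    (hc : s.card ≤ t.card) (hne : t ≠ s) : finsetProd θ t * finsetProd θ sᶜ = 0 := by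
  refine h.finsetProd_mul_eq_zero fun hd => hne ?_
  rw [disjoint_compl_right_iff] at hd
  exact Finset.eq_of_subset_of_card_le hd hc

theorem prod_mem_span (h : IsAnticommuting θ) {R : Type*} [CommRing R] [Algebra R B] (l : List ι) :
    (l.map θ).prod ∈ Submodule.span R (finsetProd θ '' {s | s.card = l.length}) := by
  classical
  by_cases hl : l.Nodup
  · have : finsetProd θ l.toFinset ∈
        Submodule.span R (finsetProd θ '' {s | s.card = l.length}) :=
      Submodule.subset_span ⟨_, List.toFinset_card_of_nodup hl, rfl⟩
    rcases h.prod_eq_finsetProd hl with e | e <;> rw [e]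
    · exact this
    · exact neg_mem this
  · rw [h.prod_eq_zero_of_not_nodup hl]
    exact zero_mem _

/-- Reordering a word in the θ costs a sign, and a repeated letter kills it; only subsets remain. -/
theorem span_pow_eq (h : IsAnticommuting θ) {R : Type*} [CommRing R] [Algebra R B] (k : ℕ) :
    Submodule.span R (Set.range θ) ^ k =
      Submodule.span R (finsetProd θ '' {s | s.card = k}) := by
  rw [Submodule.span_pow]
  apply le_antisymm
  · rw [Submodule.span_le]
    intro a ha
    obtain ⟨f, rfl⟩ := Set.mem_pow.1 ha
    choose g hg using fun i => (f i).2
    have := h.prod_mem_span (R := R) (List.ofFn g)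
    rw [List.length_ofFn, List.map_ofFn] at this
    have e : (fun i => ((f i : Set.range θ) : B)) = θ ∘ g := funext fun i => (hg i).symm
    rw [e]
    exact this
  · rw [Submodule.span_le]
    rintro _ ⟨s, rfl, rfl⟩
    refine Submodule.subset_span ?_
    rw [← Finset.length_toList, finsetProd]
    generalize s.toList = l
    induction l with
    | nil => simp
    | cons i l ih =>
      rw [List.map_cons, List.prod_cons, List.length_cons, pow_succ']
      exact Set.mul_mem_mul ⟨i, rfl⟩ ih

theorem adjoin_le_span (h : IsAnticommuting θ) {R : Type*} [CommRing R] [Algebra R B] :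
    Subalgebra.toSubmodule (Algebra.adjoin R (Set.range θ)) ≤
      Submodule.span R (Set.range (finsetProd θ)) := by
  rw [Algebra.adjoin_eq_span, Submodule.span_le]
  intro a ha
  obtain ⟨l, hl, rfl⟩ := Submonoid.exists_list_of_mem_closure ha
  have : ∃ l' : List ι, l = l'.map θ := by
    have h1 : l ∈ Set.range (List.map θ) := by rw [Set.range_list_map]; exact hl
    obtain ⟨l', e⟩ := h1
    exact ⟨l', e.symm⟩
  obtain ⟨l', rfl⟩ := this
  exact Submodule.span_mono (Set.image_subset_range _ _) (h.prod_mem_span l')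

end General

section Top

variable {q : ℕ} {θ : Fin q → B}

theorem prod_ofFn_eq (h : IsAnticommuting θ) : (List.ofFn θ).prod = finsetProd θ Finset.univ ∨
    (List.ofFn θ).prod = -finsetProd θ Finset.univ := by
  have := h.prod_eq_finsetProd (List.nodup_finRange q)
  rwa [List.toFinset_finRange, ← List.ofFn_eq_map] at this

theorem finsetProd_mul_compl (h : IsAnticommuting θ) (s : Finset (Fin q)) :
    finsetProd θ s * finsetProd θ sᶜ = (List.ofFn θ).prod ∨
      finsetProd θ s * finsetProd θ sᶜ = -(List.ofFn θ).prod := by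
  have h1 := h.finsetProd_mul_of_disjoint (s := s) (t := sᶜ) disjoint_compl_right
  rw [Finset.union_compl] at h1
  rcases h1 with e | e <;> rcases h.prod_ofFn_eq with e' | e' <;> simp [e, e']

/-- A ring homomorphism from an exterior-like algebra is injective if it is injective on the
multiples of the top product. -/
theorem injective_of_top (h : IsAnticommuting θ) {F G : Type*} [CommRing F] [Algebra F B]
    [Ring G] (φ : B →+* G)
    (hspan : Submodule.span F (Set.range (finsetProd θ)) = ⊤)
    (htop : ∀ f : F, φ (f • (List.ofFn θ).prod) = 0 → f = 0) : Function.Injective φ := by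
  rw [injective_iff_map_eq_zero]
  intro z hz
  obtain ⟨f, rfl⟩ := (Submodule.mem_span_range_iff_exists_fun F).1
    (hspan ▸ Submodule.mem_top : z ∈ Submodule.span F (Set.range (finsetProd θ)))
  suffices hf : ∀ (k : ℕ) (s : Finset (Fin q)), s.card = k → f s = 0 from
    Finset.sum_eq_zero fun s _ => by rw [hf _ s rfl, zero_smul]
  intro k
  induction k using Nat.strong_induction_on with
  | _ k ih =>
    rintro s rfl
    -- Terms of degree below that of s are already known to vanish, and the remaining ones other
    -- than s are killed by the complementary product.
    have e : (∑ t, f t • finsetProd θ t) * finsetProd θ sᶜ =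
        f s • (finsetProd θ s * finsetProd θ sᶜ) := by
      rw [Finset.sum_mul, Finset.sum_eq_single s, smul_mul_assoc]
      · intro t _ hts
        by_cases hc : t.card < s.card
        · rw [ih _ hc t rfl, zero_smul, zero_mul]
        · rw [smul_mul_assoc, h.finsetProd_mul_compl_of_ne (not_lt.1 hc) hts, smul_zero]
      · simp
    have h0 : φ (f s • (finsetProd θ s * finsetProd θ sᶜ)) = 0 := by
      rw [← e, map_mul, hz, zero_mul]
    apply htop
    rcases h.finsetProd_mul_compl s with e' | e' <;> rw [e'] at h0
    · exact h0
    · rwa [smul_neg, map_neg, neg_eq_zero] at h0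

variable {R : Type*} [CommRing R] [Algebra R B]

theorem span_pow_eq_bot (h : IsAnticommuting θ) {k : ℕ} (hk : q < k) :
    Submodule.span R (Set.range θ) ^ k = ⊥ := by
  rw [h.span_pow_eq, Submodule.span_eq_bot]
  rintro _ ⟨s, hs, rfl⟩
  have := s.card_le_univ
  rw [Fintype.card_fin] at this
  exact absurd hs (by simp; omega)

theorem span_pow_top_eq (h : IsAnticommuting θ) :
    Submodule.span R (Set.range θ) ^ q = Submodule.span R {(List.ofFn θ).prod} := by
  have e : finsetProd θ '' {s | s.card = q} = {finsetProd θ Finset.univ} := by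
    rw [← Set.image_singleton]
    congr 1
    ext s
    rw [Set.mem_ofPred_eq, Set.mem_singleton_iff, ← Finset.card_eq_iff_eq_univ, Fintype.card_fin]
  rw [h.span_pow_eq, e]
  rcases h.prod_ofFn_eq with e | e <;> rw [e]
  rw [← Set.neg_singleton, Submodule.span_neg]

/-- Multiplying by a complementary product turns a combination of products of degree k into one
coefficient times the top product. If the result is zero, that coefficient annihilates the top
product. -/
theorem mem_smul_of_mul_eq_zero (h : IsAnticommuting θ) {b c : Ideal R}
    (hb : ∀ g ∈ b, g • (List.ofFn θ).prod = 0 → g ∈ c) {k : ℕ} {a : B}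
    (ha : a ∈ b • Submodule.span R (Set.range θ) ^ k)
    (ha' : ∀ s : Finset (Fin q), s.card = k → a * finsetProd θ sᶜ = 0) :
    a ∈ c • Submodule.span R (Set.range θ) ^ k := by
  rw [h.span_pow_eq, Set.image_eq_range] at ha ⊢
  rw [Submodule.mem_ideal_smul_span_iff_exists_sum] at ha ⊢
  obtain ⟨g, hg, rfl⟩ := ha
  refine ⟨g, fun s => hb _ (hg s) ?_, rfl⟩
  have h1 := ha' s.1 s.2
  rw [Finsupp.sum, Finset.sum_mul, Finset.sum_eq_single s, smul_mul_assoc] at h1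
  · rcases h.finsetProd_mul_compl s.1 with e' | e' <;> rw [e'] at h1
    · exact h1
    · rwa [smul_neg, neg_eq_zero] at h1
  · intro t _ hts
    rw [smul_mul_assoc, h.finsetProd_mul_compl_of_ne (s.2.trans t.2.symm).le
      (fun e => hts (Subtype.ext e)), smul_zero]
  · intro hs
    rw [Finsupp.notMem_support_iff.1 hs, zero_smul, zero_mul]

/-- If the annihilator `I` of the top product consists of elements of `N ^ 2` and meets every
power of `a` in `I * a ^ n`, then a multiple of the top product that lies in
`∑ j, a ^ (M - j) N ^ j` lies in `a ^ (M - q) N ^ q`. -/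
theorem mem_smul_pow_of_mem_iSup (h : IsAnticommuting θ) {I a : Ideal R}
    (hI : ∀ n, ∀ g ∈ a ^ n, g • (List.ofFn θ).prod = 0 → g ∈ a ^ n * I)
    (hI2 : ∀ g ∈ I, algebraMap R B g ∈ Submodule.span R (Set.range θ) ^ 2) {M : ℕ} {z : B}
    (hz : z ∈ Submodule.span R {(List.ofFn θ).prod})
    (hz' : z ∈ ⨆ j : ℕ, a ^ (M - j) • Submodule.span R (Set.range θ) ^ j) :
    z ∈ a ^ (M - q) • Submodule.span R {(List.ofFn θ).prod} := by
  set N := Submodule.span R (Set.range θ) with hN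
  have hIN : ∀ k, I • N ^ k ≤ N ^ (k + 2) := by
    intro k
    rw [Submodule.smul_le]
    intro g hg n hn
    rw [Algebra.smul_def, add_comm, pow_add]
    exact Submodule.mul_mem_mul (hI2 g hg) hn
  have hNbot : ∀ {k}, q < k → N ^ k = ⊥ := fun hk => h.span_pow_eq_bot hk
  -- The lowest odd degree in the sum is q - d. It is raised one step at a time until it reaches q,
  -- beyond which N^j = 0.
  suffices H : ∀ d ≤ q, z ∈ (⨆ (j : ℕ) (_ : q - d ≤ j), a ^ (M - j) • N ^ j) →
      z ∈ a ^ (M - q) • N ^ q by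
    rw [← h.span_pow_top_eq]
    refine H q le_rfl ?_
    simpa using hz'
  intro d
  induction d with
  | zero =>
    intro _
    refine fun hz => (iSup₂_le fun j hj => ?_ : (⨆ (j : ℕ) (_ : q - 0 ≤ j), a ^ (M - j) • N ^ j) ≤
      a ^ (M - q) • N ^ q) hz
    rcases (show q ≤ j from hj).eq_or_lt with rfl | hj
    · exact le_rfl
    · rw [hNbot hj, Submodule.smul_bot]; exact bot_le
  | succ d ih =>
    intro hd hzd
    refine ih (by omega) ?_
    have hsplit : (⨆ (j : ℕ) (_ : q - (d + 1) ≤ j), a ^ (M - j) • N ^ j) ≤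
        a ^ (M - (q - (d + 1))) • N ^ (q - (d + 1)) ⊔
          ⨆ (j : ℕ) (_ : q - d ≤ j), a ^ (M - j) • N ^ j := by
      refine iSup₂_le fun j hj => ?_
      rcases hj.eq_or_lt with rfl | hj
      · exact le_sup_left
      · exact le_sup_of_le_right (le_iSup₂_of_le j (by omega) le_rfl)
    obtain ⟨u, hu, v, hv, rfl⟩ := Submodule.mem_sup.1 (hsplit hzd)
    refine add_mem ?_ hv
    set k := q - (d + 1) with hk
    have hcard : ∀ s : Finset (Fin q), s.card = k → sᶜ.card = d + 1 := by
      intro s hs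
      rw [Finset.card_compl, Fintype.card_fin, hs]
      omega
    have hmem : ∀ s : Finset (Fin q), finsetProd θ s ∈ N ^ s.card := by
      intro s
      rw [hN, h.span_pow_eq]
      exact Submodule.subset_span ⟨s, rfl, rfl⟩
    -- A complementary product has odd degree d + 1, which carries both z and v beyond degree q. So
    -- it kills u as well, and the coefficients of u may be taken in I.
    have key : u ∈ (a ^ (M - k) * I) • N ^ k := by
      refine h.mem_smul_of_mul_eq_zero (hI _) hu fun s hs => ?_
      have hs' := hmem sᶜ
      rw [hcard s hs] at hs'
      have h1 : (u + v) * finsetProd θ sᶜ = 0 := by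
        have := Submodule.mul_mem_mul hz hs'
        rw [← h.span_pow_top_eq, ← hN, ← pow_add, hNbot (by omega)] at this
        exact (Submodule.mem_bot R).1 this
      have h2 : v * finsetProd θ sᶜ = 0 := by
        have h3 := Submodule.mul_mem_mul hv hs'
        rw [Submodule.iSup_mul] at h3
        refine (Submodule.mem_bot R).1 ((iSup_le fun j => ?_ : _ ≤ (⊥ : Submodule R B)) h3)
        rw [Submodule.iSup_mul]
        refine iSup_le fun hj => ?_
        refine (mul_le_mul' (Submodule.smul_le_right : _ ≤ N ^ j) le_rfl).trans ?_
        rw [← pow_add, hNbot (by omega)]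
      rwa [add_mul, h2, add_zero] at h1
    rw [Submodule.mul_smul] at key
    have h4 := Submodule.smul_mono le_rfl (hIN k) key
    -- A coefficient in I is worth two odd degrees, so u moves to degree k + 2, above the lowest one
    -- that is still allowed.
    exact Submodule.mem_iSup_of_mem (k + 2) (Submodule.mem_iSup_of_mem (by omega)
      (Submodule.smul_mono_left (Ideal.pow_le_pow_right (by omega)) h4))

end Top

end IsAnticommuting

end Anticommuting

/-! ### Homogeneous components of products. -/

section Components

variable {A : Type u} [Ring A] (𝒜 : ZMod 2 → AddSubgroup A) [GradedRing 𝒜]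

theorem coe_decompose_zero_add {b c : A} (hb : b ∈ 𝒜 0) (hc : c ∈ 𝒜 1) :
    (DirectSum.decompose 𝒜 (b + c) 0 : A) = b := by
  rw [DirectSum.decompose_add, DirectSum.add_apply, AddSubgroup.coe_add,
    DirectSum.decompose_of_mem_same _ hb, DirectSum.decompose_of_mem_ne _ hc one_ne_zero, add_zero]

theorem coe_decompose_one_add {b c : A} (hb : b ∈ 𝒜 0) (hc : c ∈ 𝒜 1) :
    (DirectSum.decompose 𝒜 (b + c) 1 : A) = c := by
  rw [DirectSum.decompose_add, DirectSum.add_apply, AddSubgroup.coe_add,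
    DirectSum.decompose_of_mem_same _ hc, DirectSum.decompose_of_mem_ne _ hb zero_ne_one, zero_add]

theorem odd_mul_odd_mem {a b : A} (ha : a ∈ 𝒜 1) (hb : b ∈ 𝒜 1) : a * b ∈ 𝒜 0 :=
  SetLike.mul_mem_graded (i := (1 : ZMod 2)) (j := 1) ha hb

theorem even_mul_mem {i : ZMod 2} {a b : A} (ha : a ∈ 𝒜 0) (hb : b ∈ 𝒜 i) : a * b ∈ 𝒜 i := by
  have := SetLike.mul_mem_graded ha hb
  rwa [zero_add] at this

theorem mul_even_mem {i : ZMod 2} {a b : A} (ha : a ∈ 𝒜 i) (hb : b ∈ 𝒜 0) : a * b ∈ 𝒜 i := by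
  have := SetLike.mul_mem_graded ha hb
  rwa [add_zero] at this

theorem coe_decompose_zero_mul (a b : A) :
    (DirectSum.decompose 𝒜 (a * b) 0 : A) =
      DirectSum.decompose 𝒜 a 0 * DirectSum.decompose 𝒜 b 0 +
        DirectSum.decompose 𝒜 a 1 * DirectSum.decompose 𝒜 b 1 := by
  have ha0 := (DirectSum.decompose 𝒜 a 0).2
  have ha1 := (DirectSum.decompose 𝒜 a 1).2
  have hb0 := (DirectSum.decompose 𝒜 b 0).2
  have hb1 := (DirectSum.decompose 𝒜 b 1).2
  have e := congrArg₂ (· * ·) (eq_even_add_odd 𝒜 a) (eq_even_add_odd 𝒜 b)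
  generalize (DirectSum.decompose 𝒜 a 0 : A) = a0 at *
  generalize (DirectSum.decompose 𝒜 a 1 : A) = a1 at *
  generalize (DirectSum.decompose 𝒜 b 0 : A) = b0 at *
  generalize (DirectSum.decompose 𝒜 b 1 : A) = b1 at *
  have e' : a * b = (a0 * b0 + a1 * b1) + (a0 * b1 + a1 * b0) := by
    refine e.trans ?_
    noncomm_ring
  rw [e']
  exact coe_decompose_zero_add 𝒜
    (add_mem (even_mul_mem 𝒜 ha0 hb0) (odd_mul_odd_mem 𝒜 ha1 hb1))
    (add_mem (even_mul_mem 𝒜 ha0 hb1) (mul_even_mem 𝒜 ha1 hb0))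

theorem coe_decompose_one_mul (a b : A) :
    (DirectSum.decompose 𝒜 (a * b) 1 : A) =
      DirectSum.decompose 𝒜 a 0 * DirectSum.decompose 𝒜 b 1 +
        DirectSum.decompose 𝒜 a 1 * DirectSum.decompose 𝒜 b 0 := by
  have ha0 := (DirectSum.decompose 𝒜 a 0).2
  have ha1 := (DirectSum.decompose 𝒜 a 1).2
  have hb0 := (DirectSum.decompose 𝒜 b 0).2
  have hb1 := (DirectSum.decompose 𝒜 b 1).2
  have e := congrArg₂ (· * ·) (eq_even_add_odd 𝒜 a) (eq_even_add_odd 𝒜 b)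
  generalize (DirectSum.decompose 𝒜 a 0 : A) = a0 at *
  generalize (DirectSum.decompose 𝒜 a 1 : A) = a1 at *
  generalize (DirectSum.decompose 𝒜 b 0 : A) = b0 at *
  generalize (DirectSum.decompose 𝒜 b 1 : A) = b1 at *
  have e' : a * b = (a0 * b0 + a1 * b1) + (a0 * b1 + a1 * b0) := by
    refine e.trans ?_
    noncomm_ring
  rw [e']
  exact coe_decompose_one_add 𝒜
    (add_mem (even_mul_mem 𝒜 ha0 hb0) (odd_mul_odd_mem 𝒜 ha1 hb1))
    (add_mem (even_mul_mem 𝒜 ha0 hb1) (mul_even_mem 𝒜 ha1 hb0))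

end Components

/-! ### The even part of a Noetherian local super-ring. -/

section Even

variable {A : Type u} [Ring A] (𝒜 : ZMod 2 → AddSubgroup A) [GradedRing 𝒜] [SuperCommutative 𝒜]

/-- A super-commutative super-ring is an algebra over its even part. -/
instance evenAlgebra : Algebra (𝒜 0) A :=
  RingHom.toAlgebra'
    { toFun := fun a => (a : A)
      map_one' := rfl
      map_mul' := fun _ _ => rfl
      map_zero' := rfl
      map_add' := fun _ _ => rfl }
    (fun a b => even_commute 𝒜 a.2 b)

theorem algebraMap_even_apply (a : 𝒜 0) : algebraMap (𝒜 0) A a = a := rfl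

theorem even_smul_def (a : 𝒜 0) (b : A) : a • b = (a : A) * b := rfl

/-- The homogeneous components of a super-commutative super-ring are modules over the even
part. -/
def component (i : ZMod 2) : Submodule (𝒜 0) A where
  __ := 𝒜 i
  smul_mem' a _ hb := even_mul_mem 𝒜 a.2 hb

theorem mem_component {i : ZMod 2} {a : A} : a ∈ component 𝒜 i ↔ a ∈ 𝒜 i := Iff.rfl

/-- In a left combination of elements of degree i, only the even parts of the coefficients
contribute to degree i. -/
theorem mem_of_mem_span_component {i : ZMod 2} {L : Submodule (𝒜 0) A} (hL : L ≤ component 𝒜 i)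
    {a : A} (ha : a ∈ Ideal.span (L : Set A)) (hai : a ∈ 𝒜 i) : a ∈ L := by
  have key : ∀ a ∈ Ideal.span (L : Set A), (DirectSum.decompose 𝒜 a i : A) ∈ L := by
    intro a ha
    induction ha using Submodule.closure_induction with
    | zero => rw [DirectSum.decompose_zero]; exact zero_mem _
    | add x y _ _ hx hy => rw [DirectSum.decompose_add]; exact add_mem hx hy
    | smul_mem r x hx =>
      have := DirectSum.coe_decompose_mul_add_of_right_mem 𝒜 (i := 0) (a := r) (hL hx)
      rw [zero_add] at this
      rw [smul_eq_mul, this]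
      exact L.smul_mem (DirectSum.decompose 𝒜 r 0) hx
  have := key a ha
  rwa [DirectSum.decompose_of_mem_same _ hai] at this

/-- Sending an A₀-submodule of Aᵢ to the super-ideal it generates is strictly monotone, so the chain
condition descends from super-ideals. -/
theorem isNoetherian_component (hA : IsNoetherianSuperRing 𝒜) (i : ZMod 2) :
    IsNoetherian (𝒜 0) (component 𝒜 i) := by
  rw [isNoetherian_iff']
  let f : Submodule (𝒜 0) (component 𝒜 i) → HomogeneousIdeal 𝒜 := fun L =>
    ⟨Ideal.span (L.map (component 𝒜 i).subtype : Set A), Ideal.homogeneous_span 𝒜 _ (by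
      rintro _ ⟨x, -, rfl⟩; exact ⟨i, x.2⟩)⟩
  have hf : StrictMono f := by
    refine Monotone.strictMono_of_injective ?_ ?_
    · intro L L' h
      rw [← toIdeal_le_toIdeal_iff]
      exact Ideal.span_mono (Submodule.map_mono h)
    · intro L L' h
      have hle : ∀ {L L' : Submodule (𝒜 0) (component 𝒜 i)}, f L = f L' → L ≤ L' := by
        intro L L' h x hx
        have h1 : (x : A) ∈ (f L).toIdeal := Ideal.subset_span ⟨x, hx, rfl⟩
        rw [h] at h1
        have h2 := mem_of_mem_span_component 𝒜 (L := L'.map (component 𝒜 i).subtype)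
          (Submodule.map_subtype_le _ _) h1 x.2
        obtain ⟨y, hy, e⟩ := h2
        rwa [← Subtype.ext e]
      exact le_antisymm (hle h) (hle h.symm)
  exact hf.wellFoundedGT

theorem isNoetherianRing_even (hA : IsNoetherianSuperRing 𝒜) : IsNoetherianRing (𝒜 0) := by
  have := isNoetherian_component 𝒜 hA 0
  let e : component 𝒜 0 →ₗ[𝒜 0] 𝒜 0 :=
    { toFun := fun a => ⟨a.1, a.2⟩
      map_add' := fun _ _ => rfl
      map_smul' := fun _ _ => rfl }
  exact isNoetherian_of_surjective _ ((LinearMap.range_eq_top (f := e)).2 fun a => ⟨⟨a.1, a.2⟩, rfl⟩)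

theorem component_sup : component 𝒜 0 ⊔ component 𝒜 1 = ⊤ := by
  rw [eq_top_iff]
  intro a _
  obtain ⟨b, hb, c, hc, rfl⟩ := exists_even_add_odd 𝒜 a
  exact Submodule.add_mem_sup hb hc

theorem isNoetherian_even (hA : IsNoetherianSuperRing 𝒜) : IsNoetherian (𝒜 0) A := by
  have := isNoetherian_component 𝒜 hA 0
  have := isNoetherian_component 𝒜 hA 1
  have h : IsNoetherian (𝒜 0) (⊤ : Submodule (𝒜 0) A) := by
    rw [← component_sup]
    infer_instance
  exact ⟨fun s => isNoetherian_submodule.1 h s le_top⟩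

/-- The even part of `A` modulo an ideal, as a quotient of `A`. -/
def evenQuotientHom (p : Ideal (𝒜 0)) [hp : p.IsPrime] : A →+* 𝒜 0 ⧸ p where
  toFun a := Ideal.Quotient.mk p (DirectSum.decompose 𝒜 a 0)
  map_zero' := by rw [DirectSum.decompose_zero]; exact map_zero _
  map_add' a b := by rw [DirectSum.decompose_add, DirectSum.add_apply, map_add]
  map_one' := by
    rw [← map_one (Ideal.Quotient.mk p)]
    congr 1
    exact Subtype.ext (DirectSum.decompose_of_mem_same _ SetLike.GradedOne.one_mem)
  map_mul' a b := by
    rw [← map_mul, Ideal.Quotient.eq]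
    set a1 : A := (DirectSum.decompose 𝒜 a 1 : A) with ha1
    set b1 : A := (DirectSum.decompose 𝒜 b 1 : A) with hb1
    have ha : a1 ∈ 𝒜 1 := (DirectSum.decompose 𝒜 a 1).2
    have hb : b1 ∈ 𝒜 1 := (DirectSum.decompose 𝒜 b 1).2
    have e : DirectSum.decompose 𝒜 (a * b) 0 - DirectSum.decompose 𝒜 a 0 * DirectSum.decompose 𝒜 b 0
        = ⟨a1 * b1, odd_mul_odd_mem 𝒜 ha hb⟩ := by
      refine Subtype.ext ?_
      change (DirectSum.decompose 𝒜 (a * b) 0 : A) -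
        (DirectSum.decompose 𝒜 a 0 : A) * (DirectSum.decompose 𝒜 b 0 : A) = _
      rw [coe_decompose_zero_mul, add_sub_cancel_left]
    rw [e]
    -- The error in multiplicativity is a product of two odd elements; its square is zero, so it
    -- lies in every prime.
    refine hp.mem_of_pow_mem 2 ?_
    have : (⟨a1 * b1, odd_mul_odd_mem 𝒜 ha hb⟩ : 𝒜 0) ^ 2 = 0 := by
      rw [pow_two]
      refine Subtype.ext ?_
      change a1 * b1 * (a1 * b1) = 0
      rw [mul_assoc, ← mul_assoc b1, odd_anticommute 𝒜 hb ha, neg_mul, mul_neg, mul_assoc,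
        SuperCommutative.odd_sq hb, mul_zero, mul_zero, neg_zero]
    rw [this]
    exact zero_mem _

theorem evenQuotientHom_apply (p : Ideal (𝒜 0)) [hp : p.IsPrime] (a : A) :
    evenQuotientHom 𝒜 p a = Ideal.Quotient.mk p (DirectSum.decompose 𝒜 a 0) := rfl

theorem evenQuotientHom_algebraMap (p : Ideal (𝒜 0)) [hp : p.IsPrime] (a : 𝒜 0) :
    evenQuotientHom 𝒜 p a = Ideal.Quotient.mk p a := by
  rw [evenQuotientHom_apply]
  congr 1
  exact Subtype.ext (DirectSum.decompose_of_mem_same _ a.2)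

variable {𝒜} (m : HomogeneousIdeal 𝒜)

/-- The even part of a super-ideal. -/
def evenPart : Ideal (𝒜 0) := m.toIdeal.comap (algebraMap (𝒜 0) A)

theorem mem_evenPart {a : 𝒜 0} : a ∈ evenPart m ↔ (a : A) ∈ m.toIdeal := Iff.rfl

theorem mem_iff_decompose [IsMaximalSuperIdeal m] {a : A} :
    a ∈ m.toIdeal ↔ DirectSum.decompose 𝒜 a 0 ∈ evenPart m := by
  conv_lhs => rw [eq_even_add_odd 𝒜 a]
  exact Submodule.add_mem_iff_left _ (odd_mem m (DirectSum.decompose 𝒜 a 1).2)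

theorem isMaximal_evenPart [hm : IsMaximalSuperIdeal m] : (evenPart m).IsMaximal := by
  have hK := hm.isField
  let f : 𝒜 0 →+* A ⧸ m.toIdeal := (Ideal.Quotient.mk m.toIdeal).comp (algebraMap (𝒜 0) A)
  have hf : Function.Surjective f := by
    intro z
    obtain ⟨a, rfl⟩ := Ideal.Quotient.mk_surjective z
    refine ⟨DirectSum.decompose 𝒜 a 0, ?_⟩
    refine (Ideal.Quotient.eq).2 ?_
    rw [← neg_sub]
    refine neg_mem ?_
    rw [algebraMap_even_apply, sub_eq_of_eq_add' (eq_even_add_odd 𝒜 a)]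
    exact odd_mem m (DirectSum.decompose 𝒜 a 1).2
  have hker : RingHom.ker f = evenPart m := by
    ext a
    rw [RingHom.mem_ker, mem_evenPart]
    exact Ideal.Quotient.eq_zero_iff_mem
  rw [← hker]
  exact RingHom.ker_isMaximal_of_surjective (K := ResidueField m) f hf

/-- For a maximal ideal p of A₀, the kernel of A → A₀/p is a maximal super-ideal, hence equals 𝔪;
contracting it to A₀ recovers p. -/
theorem isLocalRing_even [hm : IsLocalSuperRing m] : IsLocalRing (𝒜 0) := by
  refine .of_unique_max_ideal ⟨evenPart m, isMaximal_evenPart m, fun p hp => ?_⟩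
  have hp' := hp.isPrime
  let n : HomogeneousIdeal 𝒜 := ⟨RingHom.ker (evenQuotientHom 𝒜 p), fun i a ha => by
    obtain rfl | rfl : i = 0 ∨ i = 1 := by revert i; decide
    · change evenQuotientHom 𝒜 p _ = 0
      rw [evenQuotientHom_algebraMap]
      exact ha
    · change evenQuotientHom 𝒜 p _ = 0
      rw [evenQuotientHom_apply, ← map_zero (Ideal.Quotient.mk p)]
      congr 1
      exact Subtype.ext (DirectSum.decompose_of_mem_ne _ (DirectSum.decompose 𝒜 a 1).2
        one_ne_zero)⟩
  have hn : IsMaximalSuperIdeal n := ⟨by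
    have hs : Function.Surjective (evenQuotientHom 𝒜 p) := by
      intro z
      obtain ⟨a, rfl⟩ := Ideal.Quotient.mk_surjective z
      exact ⟨a, evenQuotientHom_algebraMap 𝒜 p a⟩
    have e := RingHom.quotientKerEquivOfSurjective hs
    exact e.toMulEquiv.isField ((Ideal.Quotient.maximal_ideal_iff_isField_quotient p).1 hp)⟩
  rw [← hm.unique n hn]
  ext a
  rw [mem_evenPart]
  change a ∈ p ↔ evenQuotientHom 𝒜 p a = 0
  rw [evenQuotientHom_algebraMap, Ideal.Quotient.eq_zero_iff_mem]

end Even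

/-! ### The filtration by powers of 𝔪 in terms of even and odd degrees. -/

section Filtration

variable {A : Type u} [Ring A] {𝒜 : ZMod 2 → AddSubgroup A} [GradedRing 𝒜] [SuperCommutative 𝒜]

variable (𝒜) in
/-- The ideal of the even part that is generated by the products of two odd elements. -/
def oddSqIdeal : Ideal (𝒜 0) := (component 𝒜 1 ^ 2).comap (Algebra.linearMap (𝒜 0) A)

theorem mem_oddSqIdeal {a : 𝒜 0} : a ∈ oddSqIdeal 𝒜 ↔ (a : A) ∈ component 𝒜 1 ^ 2 := Iff.rfl

theorem oddSqIdeal_le_of_isPrime (p : Ideal (𝒜 0)) [p.IsPrime] : oddSqIdeal 𝒜 ≤ p := by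
  have h : component 𝒜 1 ^ 2 ≤ Submodule.map (Algebra.linearMap (𝒜 0) A) p := by
    rw [pow_two, Submodule.mul_le]
    intro a ha b hb
    have h1 : evenQuotientHom 𝒜 p (a * b) = 0 := by
      have h2 : evenQuotientHom 𝒜 p a = 0 := by
        rw [evenQuotientHom_apply, ← map_zero (Ideal.Quotient.mk p)]
        congr 1
        exact Subtype.ext (DirectSum.decompose_of_mem_ne _ ha one_ne_zero)
      rw [map_mul, h2, zero_mul]
    have e := evenQuotientHom_algebraMap 𝒜 p ⟨a * b, odd_mul_odd_mem 𝒜 ha hb⟩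
    rw [h1] at e
    exact ⟨_, Ideal.Quotient.eq_zero_iff_mem.1 e.symm, rfl⟩
  intro a ha
  obtain ⟨b, hb, e⟩ := h ha
  rwa [← Subtype.ext e]

theorem ringKrullDim_quotient_oddSqIdeal :
    ringKrullDim (𝒜 0 ⧸ oddSqIdeal 𝒜) = ringKrullDim (𝒜 0) := by
  have e : PrimeSpectrum.zeroLocus (oddSqIdeal 𝒜 : Set (𝒜 0)) = Set.univ := by
    ext p
    simpa using oddSqIdeal_le_of_isPrime p.asIdeal
  rw [ringKrullDim_quotient, e]
  exact Order.krullDim_eq_of_orderIso OrderIso.Set.univ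

variable (m : HomogeneousIdeal 𝒜)

theorem coe_mem_pow {n : ℕ} {b : 𝒜 0} (hb : b ∈ evenPart m ^ n) : (b : A) ∈ m.toIdeal ^ n := by
  induction n generalizing b with
  | zero => rw [Submodule.pow_zero, Ideal.one_eq_top]; trivial
  | succ n ih =>
    rw [pow_succ] at hb
    induction hb using Submodule.mul_induction_on' with
    | mem_mul_mem c hc d hd =>
      exact mul_mem_pow_add (ih hc) (by rw [Submodule.pow_one]; exact hd)
    | add c _ d _ hc hd => exact add_mem hc hd

theorem smul_pow_le {a : Ideal (𝒜 0)} (ha : a ≤ evenPart m) {k n : ℕ} {z w : A}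
    (hz : z ∈ a ^ n • Submodule.span (𝒜 0) {w}) (hw : w ∈ m.toIdeal ^ k) :
    z ∈ m.toIdeal ^ (n + k) := by
  obtain ⟨b, hb, rfl⟩ := Submodule.mem_smul_span_singleton.1 hz
  exact mul_mem_pow_add (coe_mem_pow m (Ideal.pow_right_mono ha n hb)) hw

variable [IsMaximalSuperIdeal m]

/-- `∑ⱼ 𝔞ⁿ⁻ʲ A₁ʲ`. -/
def mixedPow (a : Ideal (𝒜 0)) (n : ℕ) : Submodule (𝒜 0) A :=
  ⨆ j : ℕ, a ^ (n - j) • component 𝒜 1 ^ j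

theorem mixedPow_succ_le (a : Ideal (𝒜 0)) (n : ℕ) : mixedPow a (n + 1) ≤ mixedPow a n :=
  iSup_mono fun j => Submodule.smul_mono_left (Ideal.pow_le_pow_right (by omega))

theorem smul_mixedPow_le (a : Ideal (𝒜 0)) (n : ℕ) : a • mixedPow a n ≤ mixedPow a (n + 1) := by
  rw [mixedPow, Submodule.smul_iSup]
  refine iSup_mono fun j => ?_
  rw [← Submodule.mul_smul, ← pow_succ']
  exact Submodule.smul_mono_left (Ideal.pow_le_pow_right (by omega))

theorem mul_mixedPow_le (a : Ideal (𝒜 0)) (n : ℕ) :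
    component 𝒜 1 * mixedPow a n ≤ mixedPow a (n + 1) := by
  rw [mixedPow, Submodule.mul_iSup]
  refine iSup_le fun j => le_iSup_of_le (j + 1) ?_
  rw [Nat.add_sub_add_right, pow_succ' (component 𝒜 1), Submodule.mul_le]
  intro x hx y hy
  induction hy using Submodule.smul_induction_on' with
  | smul b hb y hy =>
    rw [mul_smul_comm]
    exact Submodule.smul_mem_smul hb (Submodule.mul_mem_mul hx hy)
  | add y _ z _ hy hz => rw [mul_add]; exact add_mem hy hz

theorem mixedPow_zero (a : Ideal (𝒜 0)) : mixedPow a 0 = ⊤ := by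
  rw [eq_top_iff, ← component_sup]
  -- Subtraction is truncated: the summand j = 1 has even exponent 0 - 1 = 0 and contributes all of
  -- A₁.
  refine sup_le (le_iSup_of_le 0 ?_) (le_iSup_of_le 1 ?_)
  · intro b hb
    rw [pow_zero, pow_zero, Ideal.one_eq_top, Submodule.top_smul]
    exact Submodule.mem_one.2 ⟨⟨b, hb⟩, rfl⟩
  · simp

/-- An element of 𝔪 is the sum of an element of a, one of A₁² and an odd one. Multiplication by each
raises the filtration by at least one; the middle term raises it by two. -/
theorem pow_le_mixedPow {a : Ideal (𝒜 0)} (ha : evenPart m ≤ a ⊔ oddSqIdeal 𝒜) (n : ℕ) :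
    ∀ z ∈ m.toIdeal ^ n, z ∈ mixedPow a n := by
  induction n with
  | zero => intro z _; rw [mixedPow_zero]; trivial
  | succ n ih =>
    have hmul : ∀ x ∈ m.toIdeal, ∀ y ∈ mixedPow a n, x * y ∈ mixedPow a (n + 1) := by
      intro x hx y hy
      rw [mem_iff_decompose] at hx
      obtain ⟨b, hb, c, hc, e⟩ := Submodule.mem_sup.1 (ha hx)
      rw [eq_even_add_odd 𝒜 x, ← e, add_mul, AddSubgroup.coe_add, add_mul]
      refine add_mem (add_mem ?_ ?_) ?_
      · exact smul_mixedPow_le a n (Submodule.smul_mem_smul hb hy)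
      · have h1 := Submodule.mul_mem_mul (mem_oddSqIdeal.1 hc) hy
        rw [pow_two, mul_assoc] at h1
        exact mixedPow_succ_le _ _ (mul_mixedPow_le a (n + 1)
          (mul_le_mul' le_rfl (mul_mixedPow_le a n) h1))
      · exact mul_mixedPow_le a n (Submodule.mul_mem_mul (DirectSum.decompose 𝒜 x 1).2 hy)
    intro z hz
    rw [Ideal.IsTwoSided.pow_succ] at hz
    induction hz using Submodule.smul_induction_on' with
    | smul x hx y hy => exact hmul x hx y (ih y hy)
    | add x _ y _ hx hy => exact add_mem hx hy

/-- This separates the error term of a lift modulo 𝔪² by parity, which is what Nakayama's lemma over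
A₀ needs. -/
theorem decompose_mem_of_mem_sq {z : A} (hz : z ∈ m.toIdeal ^ 2) :
    DirectSum.decompose 𝒜 z 0 ∈ evenPart m * evenPart m ⊔ oddSqIdeal 𝒜 ∧
      (DirectSum.decompose 𝒜 z 1 : A) ∈ evenPart m • component 𝒜 1 := by
  rw [Ideal.IsTwoSided.pow_succ, Submodule.pow_one] at hz
  induction hz using Submodule.smul_induction_on' with
  | smul x hx y hy =>
    rw [mem_iff_decompose] at hx hy
    rw [smul_eq_mul]
    constructor
    · have e : DirectSum.decompose 𝒜 (x * y) 0 =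
          DirectSum.decompose 𝒜 x 0 * DirectSum.decompose 𝒜 y 0 +
          ⟨_, odd_mul_odd_mem 𝒜 (DirectSum.decompose 𝒜 x 1).2 (DirectSum.decompose 𝒜 y 1).2⟩ :=
        Subtype.ext (coe_decompose_zero_mul 𝒜 x y)
      rw [e]
      refine Submodule.add_mem_sup (Ideal.mul_mem_mul hx hy) (mem_oddSqIdeal.2 ?_)
      rw [pow_two]
      exact Submodule.mul_mem_mul (DirectSum.decompose 𝒜 x 1).2 (DirectSum.decompose 𝒜 y 1).2
    · rw [coe_decompose_one_mul, ← even_commute 𝒜 (DirectSum.decompose 𝒜 y 0).2]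
      exact add_mem (Submodule.smul_mem_smul hx (DirectSum.decompose 𝒜 y 1).2)
        (Submodule.smul_mem_smul hy (DirectSum.decompose 𝒜 x 1).2)
  | add x _ y _ hx hy =>
    rw [DirectSum.decompose_add]
    exact ⟨add_mem hx.1 hy.1, add_mem hx.2 hy.2⟩

end Filtration

/-! ### Lifts of bases of the cotangent super-space. -/

section Parameters

variable {A : Type u} [Ring A] {𝒜 : ZMod 2 → AddSubgroup A} [GradedRing 𝒜] [SuperCommutative 𝒜]
variable (m : HomogeneousIdeal 𝒜) [IsMaximalSuperIdeal m]

/-- The projection of the even part onto the residue field. -/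
noncomputable def evenResidue : 𝒜 0 →+* ResidueField m :=
  (Ideal.Quotient.mk m.toIdeal).comp (algebraMap (𝒜 0) A)

theorem evenResidue_eq_zero {a : 𝒜 0} : evenResidue m a = 0 ↔ a ∈ evenPart m :=
  Ideal.Quotient.eq_zero_iff_mem

theorem evenResidue_surjective : Function.Surjective (evenResidue m) := by
  intro z
  obtain ⟨a, rfl⟩ := Ideal.Quotient.mk_surjective z
  refine ⟨DirectSum.decompose 𝒜 a 0, (Ideal.Quotient.eq).2 ?_⟩
  rw [← neg_sub]
  refine neg_mem ?_
  rw [algebraMap_even_apply, sub_eq_of_eq_add' (eq_even_add_odd 𝒜 a)]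
  exact odd_mem m (DirectSum.decompose 𝒜 a 1).2

theorem evenResidue_smul_grMk {n : ℕ} (a : 𝒜 0) (b : ↥(m.toIdeal ^ n)) :
    evenResidue m a • grMk m.toIdeal n b = grMk m.toIdeal n ((a : A) • b) := rfl

/-- Even elements `x` and odd elements `θ` of `𝔪` whose classes are bases of the two components of
`𝔪/𝔪²`. -/
structure Parameters (r q : ℕ) where
  /-- the basis of the even component -/
  evenBasis : Module.Basis (Fin r) (ResidueField m) (cotangentPart m 0)
  /-- the basis of the odd component -/
  oddBasis : Module.Basis (Fin q) (ResidueField m) (cotangentPart m 1)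
  /-- the even parameters -/
  x : Fin r → 𝒜 0
  /-- the odd parameters -/
  θ : Fin q → A
  x_mem : ∀ i, (x i : A) ∈ m.toIdeal ^ 1
  θ_odd : ∀ i, θ i ∈ 𝒜 1
  θ_mem : ∀ i, θ i ∈ m.toIdeal ^ 1
  x_class : ∀ i, grMk m.toIdeal 1 ⟨x i, x_mem i⟩ = evenBasis i
  θ_class : ∀ i, grMk m.toIdeal 1 ⟨θ i, θ_mem i⟩ = oddBasis i

theorem finite_cotangentPart (hA : IsNoetherianSuperRing 𝒜) (i : ZMod 2) :
    Module.Finite (ResidueField m) (cotangentPart m i) := by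
  have h1 := isNoetherian_even 𝒜 hA
  have h2 : IsNoetherian A A := isNoetherian_of_tower (𝒜 0) h1
  have h3 : Module.Finite A (GrPiece m.toIdeal 1) :=
    Module.Finite.of_surjective (grMk m.toIdeal 1) (grMk_surjective 1)
  have h4 : Module.Finite (ResidueField m) (GrPiece m.toIdeal 1) := by
    obtain ⟨s, hs⟩ := h3.fg_top
    refine ⟨⟨s, ?_⟩⟩
    rw [eq_top_iff]
    intro y _
    have hy : y ∈ Submodule.span A (s : Set (GrPiece m.toIdeal 1)) := hs ▸ Submodule.mem_top
    induction hy using Submodule.span_induction with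
    | mem y hy => exact Submodule.subset_span hy
    | zero => exact zero_mem _
    | add y z _ _ hy hz => exact add_mem (hy trivial) (hz trivial)
    | smul a y _ hy =>
      exact Submodule.smul_mem _ (Ideal.Quotient.mk m.toIdeal a : ResidueField m) (hy trivial)
  infer_instance

theorem exists_parameters (hA : IsNoetherianSuperRing 𝒜) :
    ∃ r q, Nonempty (Parameters m r q) := by
  have := finite_cotangentPart m hA 0
  have := finite_cotangentPart m hA 1
  let b0 := Module.finBasis (ResidueField m) (cotangentPart m 0)
  let b1 := Module.finBasis (ResidueField m) (cotangentPart m 1)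
  choose x hx hx' using fun i => (b0 i).2
  choose y hy hy' using fun i => (b1 i).2
  exact ⟨_, _, ⟨b0, b1, fun i => ⟨x i, hx i⟩, fun i => y i, fun i => (x i).2, hy,
    fun i => (y i).2, hx', hy'⟩⟩

theorem exists_sub_sum_mem_sq {i : ZMod 2} {k : ℕ}
    (b : Module.Basis (Fin k) (ResidueField m) (cotangentPart m i)) {y : Fin k → A}
    (hy : ∀ j, y j ∈ m.toIdeal ^ 1) (hyb : ∀ j, grMk m.toIdeal 1 ⟨y j, hy j⟩ = b j)
    {a : A} (ha : a ∈ 𝒜 i) (ham : a ∈ m.toIdeal) :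
    ∃ d : Fin k → 𝒜 0, a - ∑ j, (d j : A) * y j ∈ m.toIdeal ^ 2 := by
  have ham' : a ∈ m.toIdeal ^ 1 := by rwa [Submodule.pow_one]
  let v : cotangentPart m i := ⟨grMk m.toIdeal 1 ⟨a, ham'⟩, ⟨a, ham'⟩, ha, rfl⟩
  choose d hd using fun j => evenResidue_surjective m (b.repr v j)
  refine ⟨d, ?_⟩
  have h1 : grMk m.toIdeal 1 ⟨a, ham'⟩ =
      grMk m.toIdeal 1 (∑ j, (d j : A) • (⟨y j, hy j⟩ : ↥(m.toIdeal ^ 1))) := by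
    rw [map_sum]
    have h2 := congrArg (cotangentPart m i).subtype (b.sum_repr v)
    rw [map_sum] at h2
    refine h2.symm.trans (Finset.sum_congr rfl fun j _ => ?_)
    rw [map_smul, ← hd j, Submodule.subtype_apply, ← hyb j, evenResidue_smul_grMk]
  have h2 := grMk_eq_iff.1 h1
  simpa using h2

namespace Parameters

variable {m} {r q : ℕ} (p : Parameters m r q)

theorem x_mem_evenPart (i : Fin r) : p.x i ∈ evenPart m := by
  have := p.x_mem i
  rwa [Submodule.pow_one] at this

theorem span_x_le : Ideal.span (Set.range p.x) ≤ evenPart m := by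
  rw [Ideal.span_le]
  rintro _ ⟨i, rfl⟩
  exact p.x_mem_evenPart i

theorem isAnticommuting : IsAnticommuting p.θ where
  anti i j := odd_anticommute 𝒜 (p.θ_odd i) (p.θ_odd j)
  sq i := SuperCommutative.odd_sq (p.θ_odd i)

theorem prod_mem_pow (l : List (Fin q)) : (l.map p.θ).prod ∈ m.toIdeal ^ l.length := by
  induction l with
  | nil => exact one_mem_pow_zero _
  | cons i l ih =>
    rw [List.map_cons, List.prod_cons, List.length_cons, add_comm]
    exact mul_mem_pow_add (p.θ_mem i) ih

theorem top_mem_pow : (List.ofFn p.θ).prod ∈ m.toIdeal ^ q := by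
  have := p.prod_mem_pow (List.finRange q)
  rwa [← List.ofFn_eq_map, List.length_finRange] at this

end Parameters

end Parameters

/-! ### Generators of 𝔪₀ and A₁ by Nakayama's lemma. -/

section Nakayama

variable {A : Type u} [Ring A] {𝒜 : ZMod 2 → AddSubgroup A} [GradedRing 𝒜] [SuperCommutative 𝒜]
variable {m : HomogeneousIdeal 𝒜} [IsLocalSuperRing m]

theorem evenPart_eq_maximalIdeal [IsLocalRing (𝒜 0)] :
    evenPart m = IsLocalRing.maximalIdeal (𝒜 0) :=
  IsLocalRing.eq_maximalIdeal (isMaximal_evenPart m)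

theorem evenPart_le_jacobson : evenPart m ≤ (⊥ : Ideal (𝒜 0)).jacobson := by
  have := isLocalRing_even m
  exact le_jacobson_bot evenPart_eq_maximalIdeal.le

namespace Parameters

variable {r q : ℕ} (p : Parameters m r q)

theorem evenPart_eq (hA : IsNoetherianSuperRing 𝒜) :
    evenPart m = Ideal.span (Set.range p.x) ⊔ oddSqIdeal 𝒜 := by
  have := isNoetherianRing_even 𝒜 hA
  have hmax := isMaximal_evenPart m
  refine le_antisymm ?_ (sup_le p.span_x_le (oddSqIdeal_le_of_isPrime _))
  -- It is enough to generate 𝔪₀ up to 𝔪₀·𝔪₀. The even part of 𝔪² exceeds this only by A₁², which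
  -- the right-hand side contains.
  refine Submodule.le_of_le_smul_of_le_jacobson_bot (IsNoetherian.noetherian _)
    (evenPart_le_jacobson (m := m)) ?_
  intro a ha
  obtain ⟨d, hd⟩ := exists_sub_sum_mem_sq m p.evenBasis p.x_mem p.x_class a.2 ha
  have h1 := (decompose_mem_of_mem_sq m hd).1
  have e : DirectSum.decompose 𝒜 ((a : A) - ∑ j, (d j : A) * p.x j) 0 =
      a - ∑ j, d j * p.x j := by
    have e1 : (a : A) - ∑ j, (d j : A) * p.x j = ((a - ∑ j, d j * p.x j : 𝒜 0) : A) := by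
      have h := map_sub (algebraMap (𝒜 0) A) a (∑ j, d j * p.x j)
      rw [map_sum] at h
      exact h.symm
    rw [e1]
    exact Subtype.ext (DirectSum.decompose_of_mem_same _ (Subtype.prop _))
  rw [e] at h1
  have h2 : ∑ j, d j * p.x j ∈ Ideal.span (Set.range p.x) :=
    sum_mem fun j _ => Ideal.mul_mem_left _ _ (Ideal.subset_span ⟨j, rfl⟩)
  rw [sup_assoc, sup_comm (oddSqIdeal 𝒜), ← sub_add_cancel a (∑ j, d j * p.x j), add_comm]
  exact Submodule.add_mem_sup h2 h1

theorem span_θ (hA : IsNoetherianSuperRing 𝒜) :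
    Submodule.span (𝒜 0) (Set.range p.θ) = component 𝒜 1 := by
  have := isNoetherian_even 𝒜 hA
  refine le_antisymm (Submodule.span_le.2 ?_) ?_
  · rintro _ ⟨i, rfl⟩
    exact p.θ_odd i
  -- Here the error is the odd part of an element of 𝔪², which lies in 𝔪₀A₁.
  refine Submodule.le_of_le_smul_of_le_jacobson_bot (IsNoetherian.noetherian _)
    (evenPart_le_jacobson (m := m)) ?_
  intro a ha
  obtain ⟨d, hd⟩ := exists_sub_sum_mem_sq m p.oddBasis p.θ_mem p.θ_class ha (odd_mem m ha)
  have h1 := (decompose_mem_of_mem_sq m hd).2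
  have h3 : ∑ j, (d j : A) * p.θ j ∈ 𝒜 1 :=
    sum_mem fun j _ => even_mul_mem 𝒜 (d j).2 (p.θ_odd j)
  rw [DirectSum.decompose_of_mem_same _ (sub_mem (mem_component 𝒜 |>.1 ha) h3)] at h1
  have h2 : ∑ j, (d j : A) * p.θ j ∈ Submodule.span (𝒜 0) (Set.range p.θ) :=
    sum_mem fun j _ => Submodule.smul_mem _ (d j) (Submodule.subset_span ⟨j, rfl⟩)
  rw [← sub_add_cancel a (∑ j, (d j : A) * p.θ j), add_comm]
  exact Submodule.add_mem_sup h2 h1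

end Parameters

end Nakayama

/-! ### Classes in the associated graded ring and surjectivity of κ. -/

section GrClass

theorem mem_pow_one_iff {A : Type u} [Ring A] {I : Ideal A} {a : A} : a ∈ I ^ 1 ↔ a ∈ I := by
  rw [Submodule.pow_one]

theorem grMk_eq_zero_iff {A : Type u} [Ring A] {I : Ideal A} {n : ℕ} {a : ↥(I ^ n)} :
    grMk I n a = 0 ↔ (a : A) ∈ I ^ (n + 1) := by
  rw [← map_zero (grMk I n), grMk_eq_iff]
  simp

variable {A : Type u} [Ring A] {𝒜 : ZMod 2 → AddSubgroup A} [GradedRing 𝒜] [SuperCommutative 𝒜]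
variable (m : HomogeneousIdeal 𝒜)

/-- The class in `gr_𝔪(A)` of an element of `𝔪ⁿ`. -/
noncomputable def grClass (n : ℕ) : ↥(m.toIdeal ^ n) →+ Gr m :=
  (DirectSum.of (GrPiece m.toIdeal) n).comp (grMk m.toIdeal n).toAddMonoidHom

theorem grClass_apply (n : ℕ) (a : ↥(m.toIdeal ^ n)) :
    grClass m n a = DirectSum.of (GrPiece m.toIdeal) n (grMk m.toIdeal n a) := rfl

theorem grClass_mul {i j : ℕ} (a : ↥(m.toIdeal ^ i)) (b : ↥(m.toIdeal ^ j)) :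
    grClass m i a * grClass m j b =
      grClass m (i + j) ⟨a.1 * b.1, mul_mem_pow_add a.2 b.2⟩ :=
  DirectSum.of_mul_of _ _

theorem grClass_congr {i j : ℕ} (h : i = j) {a : ↥(m.toIdeal ^ i)} {b : ↥(m.toIdeal ^ j)}
    (hab : (a : A) = b) : grClass m i a = grClass m j b := by
  subst h
  rw [Subtype.ext hab]

theorem grClass_eq_zero_iff {n : ℕ} {a : ↥(m.toIdeal ^ n)} :
    grClass m n a = 0 ↔ (a : A) ∈ m.toIdeal ^ (n + 1) := by
  rw [grClass_apply, ← grMk_eq_zero_iff, ← map_zero (DirectSum.of (GrPiece m.toIdeal) n),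
    (DirectSum.of_injective n).eq_iff]

variable [IsMaximalSuperIdeal m]

theorem grClass_zero_eq_algebraMap (a : A) :
    grClass m 0 ⟨a, by rw [Submodule.pow_zero, Ideal.one_eq_top]; trivial⟩ =
      algebraMap (ResidueField m) (Gr m) (Ideal.Quotient.mk m.toIdeal a) := by
  rw [DirectSum.algebraMap_apply]
  refine congrArg (DirectSum.of (GrPiece m.toIdeal) 0) ?_
  refine Eq.trans ?_ (mk_smul_grMk m a ⟨1, one_mem_pow_zero _⟩).symm
  exact congrArg _ (Subtype.ext (mul_one a).symm)

/-- Powers of 𝔪 are generated by products, so degree one generates `gr` over K. A degree-one class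
splits by parity because odd elements belong to 𝔪. -/
theorem kappa_surjective : Function.Surjective (kappa m) := by
  rw [← AlgHom.range_eq_top, eq_top_iff]
  have h1 : ∀ a : ↥(m.toIdeal ^ 1), grClass m 1 a ∈ (kappa m).range := by
    intro a
    have hodd : (DirectSum.decompose 𝒜 (a : A) 1 : A) ∈ m.toIdeal ^ 1 :=
      mem_pow_one_iff.2 (odd_mem m (DirectSum.decompose 𝒜 (a : A) 1).2)
    have heven : (DirectSum.decompose 𝒜 (a : A) 0 : A) ∈ m.toIdeal ^ 1 := by
      have := sub_mem a.2 hodd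
      rwa [sub_eq_of_eq_add (eq_even_add_odd 𝒜 (a : A))] at this
    have e : a = ⟨_, heven⟩ + ⟨_, hodd⟩ := Subtype.ext (eq_even_add_odd 𝒜 (a : A))
    rw [e, map_add]
    refine add_mem ?_ ?_
    · refine ⟨SymmetricAlgebra.ι _ _ ⟨grMk m.toIdeal 1 ⟨_, heven⟩, ⟨_, heven⟩,
        (DirectSum.decompose 𝒜 (a : A) 0).2, rfl⟩ ⊗ₜ 1, ?_⟩
      refine (Algebra.TensorProduct.lift_tmul _ _ _ _ _).trans ?_
      rw [map_one, mul_one, kappaEven_ι]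
      rfl
    · refine ⟨1 ⊗ₜ ExteriorAlgebra.ι _ ⟨grMk m.toIdeal 1 ⟨_, hodd⟩, ⟨_, hodd⟩,
        (DirectSum.decompose 𝒜 (a : A) 1).2, rfl⟩, ?_⟩
      refine (Algebra.TensorProduct.lift_tmul _ _ _ _ _).trans ?_
      rw [map_one, one_mul, kappaOdd_ι]
      rfl
  have hn : ∀ n, ∀ a : ↥(m.toIdeal ^ n), grClass m n a ∈ (kappa m).range := by
    intro n
    induction n with
    | zero =>
      rintro ⟨a, ha⟩
      rw [grClass_zero_eq_algebraMap]
      exact Subalgebra.algebraMap_mem _ _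
    | succ n ih =>
      rintro ⟨a, ha⟩
      have ha' := ha
      rw [Ideal.IsTwoSided.pow_succ] at ha'
      induction ha' using Submodule.smul_induction_on' with
      | smul x hx y hy =>
        have hx1 : x ∈ m.toIdeal ^ 1 := by rwa [Submodule.pow_one]
        rw [← grClass_congr m (add_comm 1 n) (a := ⟨x * y, mul_mem_pow_add hx1 hy⟩) rfl,
          ← grClass_mul m ⟨x, hx1⟩ ⟨y, hy⟩]
        exact mul_mem (h1 _) (ih _)
      | add x hx y hy h h' =>
        rw [Ideal.smul_eq_mul, ← Ideal.IsTwoSided.pow_succ] at hx hy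
        have := add_mem (h hx) (h' hy)
        rwa [← map_add] at this
  intro z _
  induction z using DirectSum.induction_on with
  | zero => exact zero_mem _
  | of n y =>
    obtain ⟨a, rfl⟩ := grMk_surjective n y
    exact hn n a
  | add y z hy hz => exact add_mem (hy trivial) (hz trivial)

end GrClass

/-! ### κ in coordinates and the injectivity criterion. -/

section Coordinates

open MvPolynomial

variable {A : Type u} [Ring A] {𝒜 : ZMod 2 → AddSubgroup A} [GradedRing 𝒜] [SuperCommutative 𝒜]
variable {m : HomogeneousIdeal 𝒜} [IsMaximalSuperIdeal m]

namespace Parameters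

variable {r q : ℕ} (p : Parameters m r q)

/-- The element of the symmetric algebra that is given by a polynomial over the even part. -/
noncomputable def toSymmetric : MvPolynomial (Fin r) (𝒜 0) →+*
    SymmetricAlgebra (ResidueField m) (cotangentPart m 0) :=
  ((SymmetricAlgebra.equivMvPolynomial p.evenBasis).symm : _ →+* _).comp
    (MvPolynomial.map (evenResidue m))

theorem toSymmetric_surjective : Function.Surjective p.toSymmetric :=
  (SymmetricAlgebra.equivMvPolynomial p.evenBasis).symm.surjective.comp
    (MvPolynomial.map_surjective _ (evenResidue_surjective m))

theorem toSymmetric_eq_zero_iff {F : MvPolynomial (Fin r) (𝒜 0)} :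
    p.toSymmetric F = 0 ↔ ∀ α, F.coeff α ∈ evenPart m := by
  have h : p.toSymmetric F = 0 ↔ MvPolynomial.map (evenResidue m) F = 0 :=
    map_eq_zero_iff (SymmetricAlgebra.equivMvPolynomial p.evenBasis).symm
      (SymmetricAlgebra.equivMvPolynomial p.evenBasis).symm.injective
  rw [h, MvPolynomial.ext_iff]
  refine forall_congr' fun α => ?_
  rw [coeff_map, coeff_zero, evenResidue_eq_zero]

theorem kappaEven_toSymmetric_C (c : 𝒜 0) :
    kappaEven m (p.toSymmetric (C c)) =
      grClass m 0 ⟨c, by rw [Submodule.pow_zero, Ideal.one_eq_top]; trivial⟩ := by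
  rw [grClass_zero_eq_algebraMap]
  have : p.toSymmetric (C c) = algebraMap (ResidueField m) _ (evenResidue m c) := by
    change (SymmetricAlgebra.equivMvPolynomial p.evenBasis).symm (MvPolynomial.map _ (C c)) = _
    rw [map_C, ← algebraMap_eq, AlgEquiv.commutes]
  rw [this, AlgHom.commutes]
  rfl

theorem kappaEven_toSymmetric_X (i : Fin r) :
    kappaEven m (p.toSymmetric (X i)) = grClass m 1 ⟨p.x i, p.x_mem i⟩ := by
  have : p.toSymmetric (X i) = SymmetricAlgebra.ι _ _ (p.evenBasis i) := by
    change (SymmetricAlgebra.equivMvPolynomial p.evenBasis).symm (MvPolynomial.map _ (X i)) = _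
    rw [map_X, SymmetricAlgebra.equivMvPolynomial_symm_X]
  rw [this, kappaEven_ι, grClass_apply, p.x_class]
  rfl

theorem eval_x_mem {n : ℕ} {F : MvPolynomial (Fin r) (𝒜 0)} (hF : F.IsHomogeneous n) :
    (eval p.x F : A) ∈ m.toIdeal ^ n :=
  coe_mem_pow m (Ideal.pow_right_mono p.span_x_le n (eval_mem_pow hF))

theorem kappaEven_toSymmetric_monomial {α : Fin r →₀ ℕ} {c : 𝒜 0} {n : ℕ}
    (h : (monomial α c).IsHomogeneous n) :
    kappaEven m (p.toSymmetric (monomial α c)) = grClass m n ⟨_, p.eval_x_mem h⟩ := by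
  -- The degree is left existential because induction on monomials changes it. It is then determined
  -- by the monomial, unless the coefficient is zero and both sides vanish.
  have key : ∃ (n : ℕ) (h : (monomial α c).IsHomogeneous n),
      kappaEven m (p.toSymmetric (monomial α c)) = grClass m n ⟨_, p.eval_x_mem h⟩ := by
    refine induction_on_monomial (motive := fun F => ∃ (n : ℕ) (h : F.IsHomogeneous n),
      kappaEven m (p.toSymmetric F) = grClass m n ⟨_, p.eval_x_mem h⟩) ?_ ?_ α c
    · intro c
      refine ⟨0, isHomogeneous_C _ c, (p.kappaEven_toSymmetric_C c).trans (grClass_congr m rfl ?_)⟩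
      exact congrArg (fun b : 𝒜 0 => (b : A)) (eval_C c).symm
    · rintro F i ⟨n, h, e⟩
      refine ⟨n + 1, h.mul (isHomogeneous_X _ i), ?_⟩
      rw [map_mul, map_mul, e, p.kappaEven_toSymmetric_X, grClass_mul]
      refine grClass_congr m rfl ?_
      have : eval p.x (F * X i) = eval p.x F * p.x i := by rw [map_mul, eval_X]
      exact congrArg (fun b : 𝒜 0 => (b : A)) this.symm
  obtain ⟨n', h', e⟩ := key
  by_cases h0 : monomial α c = 0
  · have e0 := congrArg (fun G => kappaEven m (p.toSymmetric G)) h0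
    refine e0.trans ?_
    rw [map_zero, map_zero]
    refine (map_zero (grClass m n)).symm.trans (grClass_congr m rfl ?_)
    exact ((congrArg (fun G => ((eval p.x G : 𝒜 0) : A)) h0).trans
      (congrArg (fun b : 𝒜 0 => (b : A)) (map_zero (eval p.x)))).symm
  · obtain rfl := h.inj_right h' h0
    exact e

theorem kappaEven_toSymmetric {n : ℕ} {F : MvPolynomial (Fin r) (𝒜 0)} (hF : F.IsHomogeneous n) :
    kappaEven m (p.toSymmetric F) = grClass m n ⟨_, p.eval_x_mem hF⟩ := by
  suffices H : ∃ h : F.IsHomogeneous n,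
      kappaEven m (p.toSymmetric F) = grClass m n ⟨_, p.eval_x_mem h⟩ from H.2
  rw [F.as_sum]
  refine Finset.sum_induction _ (fun G => ∃ h : G.IsHomogeneous n,
    kappaEven m (p.toSymmetric G) = grClass m n ⟨_, p.eval_x_mem h⟩) ?_ ?_ ?_
  · rintro G H ⟨hG, eG⟩ ⟨hH, eH⟩
    refine ⟨hG.add hH, ?_⟩
    rw [map_add, map_add, eG, eH, ← map_add]
    refine grClass_congr m rfl ?_
    exact congrArg (fun b : 𝒜 0 => (b : A)) (map_add (eval p.x) G H).symm
  · refine ⟨isHomogeneous_zero _ _ _, ?_⟩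
    rw [map_zero, map_zero]
    refine (map_zero (grClass m n)).symm.trans (grClass_congr m rfl ?_)
    exact congrArg (fun b : 𝒜 0 => (b : A)) (map_zero (eval p.x)).symm
  · intro α hα
    have h : (monomial α (coeff α F)).IsHomogeneous n := by
      refine isHomogeneous_monomial _ ?_
      have := hF (mem_support_iff.1 hα)
      rwa [Pi.one_def, ← Finsupp.degree_eq_weight_one] at this
    exact ⟨h, p.kappaEven_toSymmetric_monomial h⟩

theorem kappaOdd_prod (l : List (Fin q)) :
    kappaOdd m ((l.map fun i => ExteriorAlgebra.ι (ResidueField m) (p.oddBasis i)).prod) =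
      grClass m l.length ⟨_, p.prod_mem_pow l⟩ := by
  induction l with
  | nil =>
    rw [List.map_nil, List.prod_nil, map_one]
    refine Eq.trans ?_ (grClass_congr m rfl rfl)
    rfl
  | cons i l ih =>
    rw [List.map_cons, List.prod_cons, map_mul, ih, kappaOdd_ι]
    have : cotangentIncl m 1 (p.oddBasis i) = grClass m 1 ⟨p.θ i, p.θ_mem i⟩ := by
      rw [grClass_apply, p.θ_class]
      rfl
    rw [this, grClass_mul]
    exact grClass_congr m (add_comm _ _) rfl

/-- The product of the basis of the odd component in the exterior algebra. -/
noncomputable def exteriorTop : ExteriorAlgebra (ResidueField m) (cotangentPart m 1) :=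
  (List.ofFn fun i => ExteriorAlgebra.ι (ResidueField m) (p.oddBasis i)).prod

theorem kappaOdd_exteriorTop :
    kappaOdd m p.exteriorTop = grClass m q ⟨_, p.top_mem_pow⟩ := by
  have h := p.kappaOdd_prod (List.finRange q)
  rw [exteriorTop, List.ofFn_eq_map, h]
  exact grClass_congr m (List.length_finRange) (congrArg List.prod List.ofFn_eq_map.symm)

theorem kappa_toSymmetric_tmul_top {n : ℕ} {F : MvPolynomial (Fin r) (𝒜 0)}
    (hF : F.IsHomogeneous n) :
    kappa m (p.toSymmetric F ⊗ₜ p.exteriorTop) =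
      grClass m (n + q) ⟨(eval p.x F : A) * (List.ofFn p.θ).prod,
        mul_mem_pow_add (p.eval_x_mem hF) p.top_mem_pow⟩ := by
  refine (Algebra.TensorProduct.lift_tmul _ _ _ _ _).trans ?_
  rw [p.kappaEven_toSymmetric hF, p.kappaOdd_exteriorTop, grClass_mul]

/-- The determinant of the odd basis, extended by zero to the other exterior degrees, is such a
functional. Contraction against it recovers f from f ⊗ top. -/
theorem exists_dual_exteriorTop :
    ∃ φ : ExteriorAlgebra (ResidueField m) (cotangentPart m 1) →ₗ[ResidueField m] ResidueField m,
      φ p.exteriorTop = 1 := by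
  let f : ∀ i, (cotangentPart m 1) [⋀^Fin i]→ₗ[ResidueField m] ResidueField m := fun i =>
    if hi : q = i then hi ▸ p.oddBasis.det else 0
  refine ⟨ExteriorAlgebra.liftAlternating f, ?_⟩
  have h1 := ExteriorAlgebra.liftAlternating_apply_ιMulti f (p.oddBasis : Fin q → _)
  rw [ExteriorAlgebra.ιMulti_apply] at h1
  refine h1.trans ?_
  simp only [f, dif_pos]
  exact p.oddBasis.det_self

theorem eq_zero_of_tmul_exteriorTop {f : SymmetricAlgebra (ResidueField m) (cotangentPart m 0)}
    (h : f ⊗ₜ[ResidueField m] p.exteriorTop = 0) : f = 0 := by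
  obtain ⟨φ, hφ⟩ := p.exists_dual_exteriorTop
  have h1 := congrArg (TensorProduct.rid (ResidueField m) _ ∘ φ.lTensor _) h
  simpa [hφ] using h1

/-- The images of the odd basis in the source of `κ`. -/
noncomputable def oddTensor (i : Fin q) :
    SymmetricAlgebra (ResidueField m) (cotangentPart m 0) ⊗[ResidueField m]
      ExteriorAlgebra (ResidueField m) (cotangentPart m 1) :=
  1 ⊗ₜ ExteriorAlgebra.ι _ (p.oddBasis i)

theorem isAnticommuting_oddTensor : IsAnticommuting p.oddTensor where
  anti i j := by
    rw [oddTensor, oddTensor, Algebra.TensorProduct.tmul_mul_tmul,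
      Algebra.TensorProduct.tmul_mul_tmul, ← TensorProduct.tmul_neg]
    congr 1
    exact eq_neg_of_add_eq_zero_left (ExteriorAlgebra.ι_add_mul_swap _ _)
  sq i := by
    rw [oddTensor, Algebra.TensorProduct.tmul_mul_tmul, ExteriorAlgebra.ι_sq_zero,
      TensorProduct.tmul_zero]

theorem isAnticommuting_ι : IsAnticommuting fun i : Fin q =>
    ExteriorAlgebra.ι (ResidueField m) (p.oddBasis i) where
  anti _ _ := eq_neg_of_add_eq_zero_left (ExteriorAlgebra.ι_add_mul_swap _ _)
  sq _ := ExteriorAlgebra.ι_sq_zero _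

theorem prod_oddTensor (l : List (Fin q)) : (l.map p.oddTensor).prod =
    1 ⊗ₜ (l.map fun i => ExteriorAlgebra.ι (ResidueField m) (p.oddBasis i)).prod := by
  induction l with
  | nil => rfl
  | cons i l ih =>
    rw [List.map_cons, List.prod_cons, ih, oddTensor, Algebra.TensorProduct.tmul_mul_tmul, mul_one,
      List.map_cons, List.prod_cons]

theorem prod_ofFn_oddTensor : (List.ofFn p.oddTensor).prod = 1 ⊗ₜ p.exteriorTop := by
  rw [List.ofFn_eq_map, p.prod_oddTensor, exteriorTop, List.ofFn_eq_map]

theorem span_finsetProd_ι : Submodule.span (ResidueField m) (Set.range (finsetProd fun i : Fin q =>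
    ExteriorAlgebra.ι (ResidueField m) (p.oddBasis i))) = ⊤ := by
  rw [eq_top_iff]
  refine le_trans ?_ (p.isAnticommuting_ι.adjoin_le_span (R := ResidueField m))
  intro w _
  rw [Subalgebra.mem_toSubmodule]
  induction w using ExteriorAlgebra.induction with
  | algebraMap c => exact Subalgebra.algebraMap_mem _ c
  | ι v =>
    rw [← p.oddBasis.sum_repr v, map_sum]
    refine sum_mem fun i _ => ?_
    rw [map_smul]
    exact Subalgebra.smul_mem _ (Algebra.subset_adjoin (Set.mem_range_self i)) _
  | mul a b ha hb => exact mul_mem (ha trivial) (hb trivial)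
  | add a b ha hb => exact add_mem (ha trivial) (hb trivial)

theorem span_oddTensor :
    Submodule.span (SymmetricAlgebra (ResidueField m) (cotangentPart m 0))
      (Set.range (finsetProd p.oddTensor)) = ⊤ := by
  rw [eq_top_iff]
  rintro z -
  induction z using TensorProduct.induction_on with
  | zero => exact zero_mem _
  | add a b ha hb => exact add_mem ha hb
  | tmul s w =>
    have hw : w ∈ Submodule.span (ResidueField m) (Set.range (finsetProd fun i : Fin q =>
      ExteriorAlgebra.ι (ResidueField m) (p.oddBasis i))) := p.span_finsetProd_ι ▸ Submodule.mem_top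
    induction hw using Submodule.span_induction generalizing s with
    | zero => rw [TensorProduct.tmul_zero]; exact zero_mem _
    | add a b _ _ ha hb => rw [TensorProduct.tmul_add]; exact add_mem (ha s) (hb s)
    | smul c a _ ha => rw [← TensorProduct.smul_tmul]; exact ha _
    | mem a h =>
      obtain ⟨t, rfl⟩ := h
      have := Submodule.smul_mem (Submodule.span
        (SymmetricAlgebra (ResidueField m) (cotangentPart m 0))
          (Set.range (finsetProd p.oddTensor))) s (Submodule.subset_span (Set.mem_range_self t))
      rwa [finsetProd, p.prod_oddTensor, TensorProduct.smul_tmul', smul_eq_mul, mul_one] at this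

/-- `κ` is injective if and only if, for every form `F` of degree `n` over the even part that has a
coefficient outside `𝔪`, the element `F(x) θ₁ ⋯ θ_q` does not lie in `𝔪ⁿ⁺ᵠ⁺¹`. -/
theorem kappa_injective_iff : Function.Injective (kappa m) ↔
    ∀ (n : ℕ) (F : MvPolynomial (Fin r) (𝒜 0)), F.IsHomogeneous n →
      (eval p.x F : A) * (List.ofFn p.θ).prod ∈ m.toIdeal ^ (n + q + 1) →
      ∀ α, F.coeff α ∈ evenPart m := by
  constructor
  · intro hinj n F hF hmem
    rw [← p.toSymmetric_eq_zero_iff]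
    refine p.eq_zero_of_tmul_exteriorTop (hinj ?_)
    rw [p.kappa_toSymmetric_tmul_top hF, map_zero, grClass_eq_zero_iff]
    exact hmem
  · intro h
    refine p.isAnticommuting_oddTensor.injective_of_top (kappa m : _ →+* Gr m) p.span_oddTensor ?_
    intro f hf
    obtain ⟨F, rfl⟩ := p.toSymmetric_surjective f
    rw [p.prod_ofFn_oddTensor, TensorProduct.smul_tmul', smul_eq_mul, mul_one] at hf
    rw [p.toSymmetric_eq_zero_iff]
    -- The image of the component of degree d lies in degree d + q of `gr`, so the vanishing of the
    -- sum can be tested one component at a time.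
    have hsum : ∑ d ∈ Finset.range (F.totalDegree + 1),
        kappa m (p.toSymmetric (homogeneousComponent d F) ⊗ₜ p.exteriorTop) = 0 := by
      rw [← map_sum, ← TensorProduct.sum_tmul, ← map_sum, sum_homogeneousComponent]
      exact hf
    have hcomp : ∀ d α, coeff α (homogeneousComponent d F) ∈ evenPart m := by
      intro d
      by_cases hd : d < F.totalDegree + 1
      · refine h d _ (homogeneousComponent_isHomogeneous d F) ?_
        have h1 := congrArg (fun y : Gr m => y (d + q)) hsum
        simp only [DirectSum.sum_apply, DirectSum.zero_apply] at h1
        rw [Finset.sum_eq_single d, p.kappa_toSymmetric_tmul_top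
          (homogeneousComponent_isHomogeneous d F), grClass_apply, DirectSum.of_eq_same,
          grMk_eq_zero_iff] at h1
        · exact h1
        · intro e _ hed
          rw [p.kappa_toSymmetric_tmul_top (homogeneousComponent_isHomogeneous e F),
            grClass_apply, DirectSum.of_eq_of_ne]
          omega
        · intro hd'
          exact absurd (Finset.mem_range.2 hd) hd'
      · intro α
        rw [homogeneousComponent_eq_zero _ _ (by omega), coeff_zero]
        exact zero_mem _
    intro α
    have := hcomp α.degree α
    rwa [coeff_homogeneousComponent, if_pos rfl] at this

end Parameters

end Coordinates

/-! ### Odd Krull dimension and the two implications. -/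

section Regular

open MvPolynomial IsLocalRing

variable {A : Type u} [Ring A] {𝒜 : ZMod 2 → AddSubgroup A} [GradedRing 𝒜] [SuperCommutative 𝒜]

theorem mem_evenAnnihilator {A : Type u} [Ring A] {𝒜 : ZMod 2 → AddSubgroup A} [GradedRing 𝒜]
    {a : A} {b : 𝒜 0} : b ∈ evenAnnihilator 𝒜 a ↔ (b : A) * a = 0 :=
  Iff.rfl

theorem prod_ofFn_mem_component_pow {s : ℕ} (y : Fin s → 𝒜 1) :
    (List.ofFn fun i => (y i : A)).prod ∈ component 𝒜 1 ^ s := by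
  have : ∀ l : List (Fin s), (l.map fun i => (y i : A)).prod ∈ component 𝒜 1 ^ l.length := by
    intro l
    induction l with
    | nil => rw [List.length_nil, pow_zero]; exact Submodule.mem_one.2 ⟨1, map_one _⟩
    | cons i l ih =>
      rw [List.map_cons, List.prod_cons, List.length_cons, pow_succ']
      exact Submodule.mul_mem_mul (y i).2 ih
  have h := this (List.finRange s)
  rwa [← List.ofFn_eq_map, List.length_finRange] at h

namespace Parameters

section Maximal

variable {m : HomogeneousIdeal 𝒜} [IsMaximalSuperIdeal m] {r q : ℕ}

theorem cotangentSuperDim_eq (p : Parameters m r q) : cotangentSuperDim m = ((r : ℕ∞), (q : ℕ∞)) := by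
  rw [cotangentSuperDim, rank_eq_card_basis p.evenBasis, rank_eq_card_basis p.oddBasis]
  simp

theorem isRegular_iff (p : Parameters m r q) :
    IsRegular m ↔ ringKrullDim (𝒜 0) = r ∧ oddKrullDim 𝒜 = q := by
  rw [IsRegular, p.cotangentSuperDim_eq, krullSuperDim, Prod.mk.injEq]
  rfl

end Maximal

variable {m : HomogeneousIdeal 𝒜} [IsLocalSuperRing m] {r q : ℕ}

theorem component_pow_eq_bot (p : Parameters m r q) (hA : IsNoetherianSuperRing 𝒜) {k : ℕ} (hk : q < k) :
    component 𝒜 1 ^ k = ⊥ := by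
  rw [← p.span_θ hA]
  exact p.isAnticommuting.span_pow_eq_bot hk

theorem component_pow_top (p : Parameters m r q) (hA : IsNoetherianSuperRing 𝒜) :
    component 𝒜 1 ^ q = Submodule.span (𝒜 0) {(List.ofFn p.θ).prod} := by
  rw [← p.span_θ hA]
  exact p.isAnticommuting.span_pow_top_eq

theorem oddSqIdeal_le_evenAnnihilator (p : Parameters m r q) (hA : IsNoetherianSuperRing 𝒜) :
    oddSqIdeal 𝒜 ≤ evenAnnihilator 𝒜 (List.ofFn p.θ).prod := by
  intro a ha
  have h1 : (List.ofFn p.θ).prod ∈ component 𝒜 1 ^ q := by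
    rw [p.component_pow_top hA]; exact Submodule.mem_span_singleton_self _
  have h2 := Submodule.mul_mem_mul (mem_oddSqIdeal.1 ha) h1
  rw [← pow_add, p.component_pow_eq_bot hA (by omega)] at h2
  exact (Submodule.mem_bot _).1 h2

/-- A product of more than q odd elements is zero, so its annihilator is all of A₀. The quotient
then has dimension ⊥, whereas dim A₀ ≥ 0. -/
theorem le_of_isSystemOfOddParameters (p : Parameters m r q) (hA : IsNoetherianSuperRing 𝒜)
    {s : ℕ} {y : Fin s → 𝒜 1}
    (hy : IsSystemOfOddParameters 𝒜 y) : s ≤ q := by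
  by_contra! hs
  have := isLocalRing_even m
  have h1 := prod_ofFn_mem_component_pow y
  rw [p.component_pow_eq_bot hA hs, Submodule.mem_bot] at h1
  rw [IsSystemOfOddParameters, h1] at hy
  have h2 : evenAnnihilator 𝒜 (0 : A) = ⊤ := by
    rw [Ideal.eq_top_iff_one, mem_evenAnnihilator, mul_zero]
  have h3 : Subsingleton (𝒜 0 ⧸ evenAnnihilator 𝒜 (0 : A)) :=
    Ideal.Quotient.subsingleton_iff.2 h2
  rw [ringKrullDim_eq_bot_of_subsingleton (R := 𝒜 0 ⧸ evenAnnihilator 𝒜 (0 : A))] at hy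
  have h4 := ringKrullDim_nonneg_of_nontrivial (R := 𝒜 0)
  rw [hy] at h4
  exact absurd h4 (by simp)

/-- Any product of q odd elements is a multiple of θ₁⋯θ_q, so its annihilator is at least as large.
If some system of length q exists, the θ form one. -/
theorem oddKrullDim_eq_iff (p : Parameters m r q) (hA : IsNoetherianSuperRing 𝒜) :
    oddKrullDim 𝒜 = q ↔
      ringKrullDim (𝒜 0) = ringKrullDim (𝒜 0 ⧸ evenAnnihilator 𝒜 (List.ofFn p.θ).prod) := by
  constructor
  · intro h
    -- A supremum equal to 0 yields no witness, so q = 0 is done by hand: the empty product is 1 and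
    -- has zero annihilator. For q + 1, some system must be longer than q.
    cases q with
    | zero =>
      have h1 : evenAnnihilator 𝒜 (List.ofFn p.θ).prod = ⊥ := by
        rw [eq_bot_iff]
        intro a ha
        rw [mem_evenAnnihilator, List.ofFn_zero, List.prod_nil, mul_one] at ha
        exact Subtype.ext ha
      rw [h1]
      exact ringKrullDim_eq_of_ringEquiv (RingEquiv.quotientBot (𝒜 0)).symm
    | succ q =>
      have h1 : ∃ (s : ℕ) (y : Fin s → 𝒜 1), IsSystemOfOddParameters 𝒜 y ∧ q < s := by
        by_contra! hn
        have h2 : oddKrullDim 𝒜 ≤ q := iSup₂_le fun s ⟨y, hy⟩ => by exact_mod_cast hn s y hy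
        rw [h] at h2
        norm_cast at h2
        omega
      obtain ⟨s, y, hy, hs⟩ := h1
      obtain rfl : s = q + 1 := le_antisymm (p.le_of_isSystemOfOddParameters hA hy) hs
      have h2 := prod_ofFn_mem_component_pow y
      rw [p.component_pow_top hA] at h2
      obtain ⟨c, hc⟩ := Submodule.mem_span_singleton.1 h2
      refine le_antisymm ?_ (ringKrullDim_quotient_le _)
      rw [show ringKrullDim (𝒜 0) = _ from hy]
      refine ringKrullDim_le_of_surjective (Ideal.Quotient.factor ?_)
        (Ideal.Quotient.factor_surjective _)
      intro a ha
      rw [mem_evenAnnihilator] at ha ⊢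
      rw [← hc, even_smul_def, ← mul_assoc, even_commute 𝒜 a.2, mul_assoc, ha, mul_zero]
  · intro h
    apply le_antisymm
    · exact iSup₂_le fun s ⟨y, hy⟩ => by
        exact_mod_cast p.le_of_isSystemOfOddParameters hA hy
    · exact le_iSup₂_of_le q ⟨fun i => ⟨p.θ i, p.θ_odd i⟩, h⟩ le_rfl

theorem span_mk_x (p : Parameters m r q) (hA : IsNoetherianSuperRing 𝒜) [IsLocalRing (𝒜 0)]
    {K : Ideal (𝒜 0)}
    (hK : oddSqIdeal 𝒜 ≤ K) (hK' : K ≤ maximalIdeal (𝒜 0)) [IsLocalRing (𝒜 0 ⧸ K)] :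
    Ideal.span (Set.range fun i => Ideal.Quotient.mk K (p.x i)) = maximalIdeal (𝒜 0 ⧸ K) := by
  rw [span_range_mk, maximalIdeal_quotient hK', ← evenPart_eq_maximalIdeal (m := m),
    p.evenPart_eq hA, Ideal.map_sup, Ideal.map_mk_eq_bot_of_le hK, sup_bot_eq]

theorem mem_evenPart_of_isRegular (p : Parameters m r q) (hA : IsNoetherianSuperRing 𝒜) (hreg : IsRegular m)
    {n : ℕ}
    {F : MvPolynomial (Fin r) (𝒜 0)} (hF : F.IsHomogeneous n)
    (hmem : (eval p.x F : A) * (List.ofFn p.θ).prod ∈ m.toIdeal ^ (n + q + 1)) :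
    ∀ α, F.coeff α ∈ evenPart m := by
  have := isLocalRing_even m
  have := isNoetherianRing_even 𝒜 hA
  obtain ⟨hr, hq⟩ := p.isRegular_iff.1 hreg
  rw [p.oddKrullDim_eq_iff hA] at hq
  have hI : oddSqIdeal 𝒜 ≤ maximalIdeal (𝒜 0) := oddSqIdeal_le_of_isPrime _
  have := isLocalRing_quotient hI
  have hspan := p.span_mk_x hA le_rfl hI
  have hQR := isQuasiRegular_of_le_ringKrullDim
    (by rw [ringKrullDim_quotient_oddSqIdeal, hr]) hspan
  have := hQR.isDomain hspan
  -- Both quotients have dimension r and A₀/I is a domain; killing a nonzero element of it would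
  -- lower the dimension.
  have hann : evenAnnihilator 𝒜 (List.ofFn p.θ).prod = oddSqIdeal 𝒜 := by
    refine le_antisymm ?_ (p.oddSqIdeal_le_evenAnnihilator hA)
    intro a ha
    by_contra hna
    have h0 : Ideal.Quotient.mk (oddSqIdeal 𝒜) a ≠ 0 := fun h =>
      hna (Ideal.Quotient.eq_zero_iff_mem.1 h)
    have h1 := ringKrullDim_succ_le_of_surjective
      (Ideal.Quotient.factor (p.oddSqIdeal_le_evenAnnihilator hA))
      (Ideal.Quotient.factor_surjective _) (mem_nonZeroDivisors_of_ne_zero h0)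
      (by rw [Ideal.Quotient.factor_mk]; exact Ideal.Quotient.eq_zero_iff_mem.2 ha)
    rw [← hq, ringKrullDim_quotient_oddSqIdeal, hr] at h1
    norm_cast at h1
    omega
  set a := Ideal.span (Set.range p.x) with ha_def
  have ha : a ≤ (⊥ : Ideal (𝒜 0)).jacobson := p.span_x_le.trans evenPart_le_jacobson
  have hspanθ := p.span_θ hA
  have key : (eval p.x F : A) * (List.ofFn p.θ).prod ∈
      a ^ (n + q + 1 - q) • Submodule.span (𝒜 0) {(List.ofFn p.θ).prod} := by
    refine p.isAnticommuting.mem_smul_pow_of_mem_iSup (I := oddSqIdeal 𝒜) ?_ ?_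
      (Submodule.smul_mem _ _ (Submodule.mem_span_singleton_self _)) ?_
    · intro k g hg hgP
      rw [mul_comm]
      refine inf_pow_le_mul_pow ha hQR k ⟨?_, hg⟩
      rw [← hann]
      exact hgP
    · intro g hg
      rw [hspanθ]
      exact mem_oddSqIdeal.1 hg
    · rw [hspanθ]
      exact pow_le_mixedPow m (p.evenPart_eq hA).le _ _ hmem
  obtain ⟨g, hg, e⟩ := Submodule.mem_smul_span_singleton.1 key
  rw [show n + q + 1 - q = n + 1 by omega] at hg
  -- Since F(x) and g have the same product with the top, their difference annihilates it. So F(x) ∈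
  -- (x)^(n+1) + I, which is the hypothesis of quasi-regularity modulo I.
  have h1 : eval p.x F - g ∈ oddSqIdeal 𝒜 := by
    rw [← hann, mem_evenAnnihilator, AddSubgroup.coe_sub, sub_mul, ← e, even_smul_def, sub_self]
  rw [p.evenPart_eq hA]
  refine (isQuasiRegular_mk_iff _ _).1 hQR n F hF ?_
  rw [← add_sub_cancel g (eval p.x F)]
  exact Submodule.add_mem_sup hg h1

theorem isRegular_of_forall (p : Parameters m r q) (hA : IsNoetherianSuperRing 𝒜)
    (h : ∀ (n : ℕ) (F : MvPolynomial (Fin r) (𝒜 0)), F.IsHomogeneous n →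
      (eval p.x F : A) * (List.ofFn p.θ).prod ∈ m.toIdeal ^ (n + q + 1) →
      ∀ α, F.coeff α ∈ evenPart m) : IsRegular m := by
  have := isLocalRing_even m
  have := isNoetherianRing_even 𝒜 hA
  have hI : oddSqIdeal 𝒜 ≤ maximalIdeal (𝒜 0) := oddSqIdeal_le_of_isPrime _
  have := isLocalRing_quotient hI
  set J := evenAnnihilator 𝒜 (List.ofFn p.θ).prod with hJ_def
  have hIJ : oddSqIdeal 𝒜 ≤ J := p.oddSqIdeal_le_evenAnnihilator hA
  have hJ : J ≤ maximalIdeal (𝒜 0) := by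
    refine le_maximalIdeal fun hJ => ?_
    have h1 : (1 : 𝒜 0) ∈ J := hJ ▸ Submodule.mem_top
    rw [hJ_def, mem_evenAnnihilator] at h1
    -- The constant form 1 shows that the top product is nonzero: otherwise 1 would lie in 𝔪₀.
    have h2 := h 0 (C 1) (isHomogeneous_C _ _) (by
      rw [eval_C, h1]
      exact zero_mem _) 0
    rw [coeff_C, if_pos rfl] at h2
    exact (Ideal.ne_top_iff_one _).1 (isMaximal_evenPart m).ne_top h2
  have := isLocalRing_quotient hJ
  have hQR : IsQuasiRegular fun i => Ideal.Quotient.mk J (p.x i) := by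
    rw [isQuasiRegular_mk_iff]
    intro n F hF hev α
    -- If F(x) = g + j with g ∈ (x)^(n+1) and j ∈ J, then j kills the top product and F(x)P = gP
    -- lies in 𝔪^(n+1+q), so the hypothesis applies.
    refine sup_le_sup_left hIJ _ ((p.evenPart_eq hA).le (h n F hF ?_ α))
    obtain ⟨g, hg, j, hj, e⟩ := Submodule.mem_sup.1 hev
    rw [← e, AddSubgroup.coe_add, add_mul, show (j : A) * _ = 0 from hj, add_zero]
    rw [add_right_comm]
    exact smul_pow_le m p.span_x_le (Submodule.smul_mem_smul hg
      (Submodule.mem_span_singleton_self _)) p.top_mem_pow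
  have h1 := hQR.le_ringKrullDim (p.span_mk_x hA hIJ hJ)
  have h2 := ringKrullDim_quotient_le J
  have h3 := ringKrullDim_le_of_maximalIdeal_eq_span (p.span_mk_x hA le_rfl hI)
  rw [ringKrullDim_quotient_oddSqIdeal] at h3
  refine p.isRegular_iff.2 ⟨le_antisymm h3 (h1.trans h2), (p.oddKrullDim_eq_iff hA).2 ?_⟩
  exact le_antisymm (h3.trans h1) h2

end Parameters

end Regular

end SuperRing

theorem mainTheorem1 {A : Type*} [Ring A] (𝒜 : ZMod 2 → AddSubgroup A) [GradedRing 𝒜]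
    [SuperRing.SuperCommutative 𝒜] (hA : SuperRing.IsNoetherianSuperRing 𝒜)
    (m : HomogeneousIdeal 𝒜) [SuperRing.IsLocalSuperRing m] :
    Function.Surjective (SuperRing.kappa m) ∧
      (SuperRing.IsRegular m ↔ Function.Bijective (SuperRing.kappa m)) := by
  have hs := SuperRing.kappa_surjective m
  obtain ⟨r, q, ⟨p⟩⟩ := SuperRing.exists_parameters m hA
  refine ⟨hs, fun h => ⟨?_, hs⟩, fun h => ?_⟩
  · exact p.kappa_injective_iff.2 fun n F hF => p.mem_evenPart_of_isRegular hA h hF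
  · exact p.isRegular_of_forall hA (p.kappa_injective_iff.1 h.1)
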